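/- Let $M$ be a compact, oriented, three-dimensional smooth Riemannian manifold without boundary, with Levi-Civita connection $\nabla$, and let $J\subset\mathbb{R}$ be a nondegenerate interval with $0\in J$. Let $u$ be a smooth (time-dependent) solution on $J\times M$ of the Euler equation $\partial_t u+P(\nabla_u u)=0$, $\operatorname{div}u=0$, where $P(w)=w-\nabla\Delta^{-1}\operatorname{div}w$, and let $\eta$ be its flow, a smooth curve of diffeomorphisms of $M$ with $\eta(0)=\mathrm{id}$ and $\partial_t\eta(t,x)=u(t,\eta(t,x))$. Write $\Lambda(t,x)=D\eta(t,x)^{T}D\eta(t,x)$, $u_o=u(0)$, and let $\Phi_o\colon M\to\mathbb{R}$ be $C^1$. (1) A function $\Phi\colon J\times M\to\mathbb{R}$ is a $C^1$ solution of the phase equation $\partial_t\Phi+u(\Phi)=0$ with $\Phi(0)=\Phi_o$ if and only if $\Phi(t)=\Phi_o\circ\eta(t)^{-1}$ for all $t\in J$. In this case $\nabla\Phi(t)=(D\eta(t)^{-1})^{\star}\nabla\Phi_o$ for all $t\in J$, that is, $\nabla\Phi(t)(y)=\bigl(D(\eta(t)^{-1})(y)\bigr)^{\star}\,\nabla\Phi_o(\eta(t)^{-1}(y))$.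 (2) Let $\Phi$ be this solution, and let $a$ be a time-dependent vector field which is $C^1$ on $\{(t,y)\in J\times M:\nabla\Phi(t,y)\neq0\}$. The following three statements are equivalent. (i) $\langle a(0),\nabla\Phi_o\rangle=0$ wherever $\nabla\Phi_o\ne0$, and $a$ satisfies the amplitude equation $$\partial_t a+\nabla_u a+\nabla_a u=2\,\frac{\langle\nabla_a u,\nabla\Phi\rangle}{\langle\nabla\Phi,\nabla\Phi\rangle}\,\nabla\Phi$$ at all points $(t,y)\in J\times M$ with $\nabla\Phi(t,y)\ne0$. (ii) For every $x$ with $\nabla\Phi_o(x)\neq0$, the vector field $\alpha(t)=a(t,\eta(t,x))$ along $t\mapsto\eta(t,x)$ satisfies, for all $t\in J$, $$\frac{D\alpha}{dt}+\nabla_{\alpha(t)}u(t)=2\,\frac{\langle\nabla_{\alpha(t)}u(t),\nabla\Phi(t)\rangle}{\langle\nabla\Phi(t),\nabla\Phi(t)\rangle}\,\nabla\Phi(t),\qquad \langle\alpha(t),\nabla\Phi(t)\rangle=0,$$ with $\nabla\Phi(t)$ taken at $\eta(t,x)$; here $\alpha(0)=a(0,x)$ because $\eta(0)=\mathrm{id}$.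 (iii) For every $x_o$ with $\xi_o:=\nabla\Phi_o(x_o)\neq0$ one can write $a(t,\eta(t,x_o))=D\eta(t,x_o)\,\beta(t)$, $t\in J$, where $\beta(t)\in T_{x_o}M$ satisfies, with $\omega_o=(\operatorname{curl}u_o)(x_o)$ and $\pi_{\xi_o^\perp}$ the orthogonal projection onto the orthogonal complement of $\xi_o$, $$\frac{d}{dt}\bigl(\pi_{\xi_o^\perp}\Lambda(t,x_o)\beta(t)\bigr)+\frac{\langle\xi_o,\omega_o\rangle}{\langle\xi_o,\xi_o\rangle}\,\xi_o\times\beta(t)=0,\qquad \beta(0)=a(0,x_o),\qquad\langle\beta(t),\xi_o\rangle=0\quad(t\in J).$$ In particular, if $\lvert\xi_o\rvert=1$ the zeroth-order term is $\langle\xi_o,\omega_o\rangle\,\xi_o\times\beta(t)$. -/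

import Mathlib

open Set Bundle Manifold
open scoped ContDiff InnerProductSpace

namespace WKB

/-- The model space of a three-dimensional manifold. -/
abbrev E3 : Type := EuclideanSpace ℝ (Fin 3)

/-- The tangent space `T_x M` of a three-dimensional manifold `M`. -/
abbrev T {M : Type*} [TopologicalSpace M] [ChartedSpace E3 M] (x : M) : Type :=
  TangentSpace (𝓡 3) x

section Geometry

variable {M : Type*} [TopologicalSpace M] [ChartedSpace E3 M]

instance finiteDimensional_tangent (x : M) : FiniteDimensional ℝ (T x) :=
  inferInstanceAs (FiniteDimensional ℝ E3)

instance fact_finrank_tangent (x : M) : Fact (Module.finrank ℝ (T x) = 3) :=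
  ⟨finrank_euclideanSpace_fin (𝕜 := ℝ) (n := 3)⟩

/-- The components, in the preferred chart at `p`, of a tangent vector at `q`
(for `q` in the domain of that chart). For `q = p` this is the identity, because
`T p` is by definition `E3`, read in the preferred chart at `p`. -/
noncomputable def coords (p q : M) : T q →L[ℝ] E3 :=
  mfderiv (𝓡 3) 𝓘(ℝ, E3) (extChartAt (𝓡 3) p) q

/-- The tangent vector `∑ aⁱ ∂ᵢ` at the point with coordinates `y` in the preferred chart
at `p`. -/
noncomputable def coordVec (p : M) (y : E3) : E3 →L[ℝ] T ((extChartAt (𝓡 3) p).symm y) :=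
  mfderiv 𝓘(ℝ, E3) (𝓡 3) (extChartAt (𝓡 3) p).symm y

variable [RiemannianBundle (fun x : M => TangentSpace (𝓡 3) x)]

instance complete_tangent (x : M) : CompleteSpace (T x) :=
  FiniteDimensional.complete ℝ (T x)

/-- The vector dual to a covector, through the Riemannian metric. -/
noncomputable def sharp (x : M) (l : T x →L[ℝ] ℝ) : T x :=
  (InnerProductSpace.toDual ℝ (T x)).symm l

/-- The Riemannian metric in the preferred chart at `p`: `metricCoeff p b c y = ∑ g_ij(y) bⁱ cʲ`. -/
noncomputable def metricCoeff (p : M) (b c : E3) (y : E3) : ℝ :=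
  ⟪coordVec p y b, coordVec p y c⟫_ℝ

/-- The derivative at `p` of the metric coefficients in the preferred chart at `p`:
`metricDeriv p a b c = ∂_a g(b, c)`. -/
noncomputable def metricDeriv (p : M) (a b c : E3) : ℝ :=
  fderiv ℝ (metricCoeff p b c) (extChartAt (𝓡 3) p p) a

/-- The Christoffel symbols of the Levi-Civita connection at `p`, in the preferred chart at `p`:
`Γ(a, b)` is the vector such that, for all `c`,
`⟨Γ(a, b), c⟩ = (∂_a g(b, c) + ∂_b g(a, c) - ∂_c g(a, b)) / 2`. -/
noncomputable def christoffel (p : M) (a b : T p) : T p :=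
  ∑ i, ((metricDeriv p a b (stdOrthonormalBasis ℝ (T p) i)
      + metricDeriv p b a (stdOrthonormalBasis ℝ (T p) i)
      - metricDeriv p (stdOrthonormalBasis ℝ (T p) i) a b) / 2) • stdOrthonormalBasis ℝ (T p) i

/-- The Levi-Civita covariant derivative `∇_v Y` at `p`, computed in the preferred chart at `p`
as `∂_v Y + Γ(v, Y)`. -/
noncomputable def covDeriv (Y : ∀ x : M, T x) (p : M) (v : T p) : T p :=
  (show T p from fderiv ℝ
      (fun y : E3 => coords p ((extChartAt (𝓡 3) p).symm y) (Y ((extChartAt (𝓡 3) p).symm y)))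
      (extChartAt (𝓡 3) p p) v) + christoffel p v (Y p)

/-- `HasCovDerivAlong J γ α t Z`: within the time interval `J`, the vector field `α` along
the curve `γ` has at time `t` the covariant derivative `Dα/dt = Z`. In the preferred chart at
`γ t` this says that `γ` has a velocity `v` and that the components of `α` are differentiable with
`dα/dt + Γ(v, α) = Z`. -/
def HasCovDerivAlong (J : Set ℝ) (γ : ℝ → M) (α : ∀ t : ℝ, T (γ t)) (t : ℝ) (Z : T (γ t)) : Prop :=
  ∃ v : T (γ t),
    HasMFDerivWithinAt 𝓘(ℝ, ℝ) (𝓡 3) γ J t (ContinuousLinearMap.toSpanSingleton ℝ v) ∧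
    HasDerivWithinAt (fun s => coords (γ t) (γ s) (α s)) (Z - christoffel (γ t) v (α t)) J t

/-- The Riemannian gradient. -/
noncomputable def grad (f : M → ℝ) (x : M) : T x :=
  sharp x (mfderiv (𝓡 3) 𝓘(ℝ, ℝ) f x)

/-- The divergence, `div Y = tr (v ↦ ∇_v Y)`. -/
noncomputable def divergence (Y : ∀ x : M, T x) (x : M) : ℝ :=
  ∑ i, ⟪covDeriv Y x (stdOrthonormalBasis ℝ (T x) i), stdOrthonormalBasis ℝ (T x) i⟫_ℝ

/-- The Laplace-Beltrami operator. -/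
noncomputable def laplacian (f : M → ℝ) (x : M) : ℝ :=
  divergence (grad f) x

open Classical in
/-- `Δ⁻¹ g`: a smooth solution `f` of `Δ f = g` (on a closed manifold it is unique up to locally
constant functions), and `0` if there is none. -/
noncomputable def invLaplacian (g : M → ℝ) : M → ℝ :=
  if h : ∃ f : M → ℝ, ContMDiff (𝓡 3) 𝓘(ℝ, ℝ) ∞ f ∧ ∀ x, laplacian f x = g x
  then h.choose else 0

/-- The projection `P W = W - ∇ Δ⁻¹ div W` onto divergence-free vector fields. -/
noncomputable def leray (W : ∀ x : M, T x) (x : M) : T x :=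
  W x - grad (invLaplacian (divergence W)) x

/-- The cross product of an oriented three-dimensional tangent space:
`⟨a × b, c⟩ = vol(a, b, c)`. -/
noncomputable def cross {x : M} (o : Orientation ℝ (T x) (Fin 3)) (a b : T x) : T x :=
  ∑ i, o.volumeForm ![a, b, stdOrthonormalBasis ℝ (T x) i] • stdOrthonormalBasis ℝ (T x) i

/-- The curl, `curl Y = ∑ eᵢ × ∇_{eᵢ} Y` for an orthonormal basis `eᵢ` of `T_x M`. -/
noncomputable def curl {x : M} (o : Orientation ℝ (T x) (Fin 3)) (Y : ∀ x : M, T x) : T x :=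
  ∑ i, cross o (stdOrthonormalBasis ℝ (T x) i) (covDeriv Y x (stdOrthonormalBasis ℝ (T x) i))

/-- The orthogonal projection `π_{ξ^⊥}` of `T_x M` onto the orthogonal complement of `ξ`. -/
noncomputable def projPerp {x : M} (ξ : T x) : T x →L[ℝ] T x :=
  (ℝ ∙ ξ)ᗮ.starProjection

variable [IsManifold (𝓡 3) ∞ M]

/-- A smooth, possibly time-dependent solution `u` on the time interval `J` of the Euler equation
`∂u/∂t + P(∇_u u) = 0`, `div u = 0`. -/
structure IsEulerSolution (J : Set ℝ) (u : ℝ → ∀ x : M, T x) : Prop where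
  smooth : ContMDiffOn (𝓘(ℝ, ℝ).prod (𝓡 3)) (𝓡 3).tangent ∞
    (fun p : ℝ × M => (⟨p.2, u p.1 p.2⟩ : TangentBundle (𝓡 3) M)) (J ×ˢ univ)
  div_free : ∀ t ∈ J, ∀ x, divergence (u t) x = 0
  euler : ∀ t ∈ J, ∀ x,
    derivWithin (fun s => u s x) J t + leray (fun y => covDeriv (u t) y (u t y)) x = 0

/-- `η` is the flow of `u`: a smooth curve of diffeomorphisms of `M`, defined for times in `J`,
with `η(0) = id` and `∂η/∂t (t, x) = u(t, η(t, x))`. -/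
structure IsFlow (J : Set ℝ) (u : ℝ → ∀ x : M, T x) (η : ℝ → M ≃ₘ⟮𝓡 3, 𝓡 3⟯ M) : Prop where
  smooth : ContMDiffOn (𝓘(ℝ, ℝ).prod (𝓡 3)) (𝓡 3) ∞ (fun p : ℝ × M => η p.1 p.2) (J ×ˢ univ)
  smooth_symm : ContMDiffOn (𝓘(ℝ, ℝ).prod (𝓡 3)) (𝓡 3) ∞
    (fun p : ℝ × M => (η p.1).symm p.2) (J ×ˢ univ)
  zero : ∀ x, η 0 x = x
  flow : ∀ t ∈ J, ∀ x, HasMFDerivWithinAt 𝓘(ℝ, ℝ) (𝓡 3) (fun s => η s x) J t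
    (ContinuousLinearMap.toSpanSingleton ℝ (u t (η t x)))

/-- The differential `Dη(x) : T_x M → T_{η(x)} M` of a diffeomorphism. -/
noncomputable def D (η : M ≃ₘ⟮𝓡 3, 𝓡 3⟯ M) (x : M) : T x →L[ℝ] T (η x) :=
  mfderiv (𝓡 3) (𝓡 3) η x

/-- The metric deformation `Λ = Dηᵀ Dη` at `x`. -/
noncomputable def deformation (η : M ≃ₘ⟮𝓡 3, 𝓡 3⟯ M) (x : M) : T x →L[ℝ] T x :=
  (ContinuousLinearMap.adjoint (D η x)).comp (D η x)

/-- `Φ` is a (`C¹`) solution of the phase equation `∂Φ/∂t + u(Φ) = 0`. -/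
structure IsPhase (J : Set ℝ) (u : ℝ → ∀ x : M, T x) (Φ : ℝ → M → ℝ) : Prop where
  contMDiff : ContMDiffOn (𝓘(ℝ, ℝ).prod (𝓡 3)) 𝓘(ℝ, ℝ) 1
    (fun p : ℝ × M => Φ p.1 p.2) (J ×ˢ univ)
  eqn : ∀ t ∈ J, ∀ x,
    derivWithin (fun s => Φ s x) J t + (show ℝ from mfderiv (𝓡 3) 𝓘(ℝ, ℝ) (Φ t) x (u t x)) = 0

/-- The set of points `(t, y)`, `t ∈ J`, where `∇Φ ≠ 0`; it is there that the coefficient of the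
amplitude equation is defined. -/
def regularSet (J : Set ℝ) (Φ : ℝ → M → ℝ) : Set (ℝ × M) :=
  {p | p.1 ∈ J ∧ grad (Φ p.1) p.2 ≠ 0}

/-- The vector `2 (⟨∇_b u, ∇Φ⟩ / ⟨∇Φ, ∇Φ⟩) ∇Φ` at `y`, for `b ∈ T_y M`. -/
noncomputable def amplitudeForce (u : ∀ x : M, T x) (Φ : M → ℝ) (y : M) (b : T y) : T y :=
  (2 * (⟪covDeriv u y b, grad Φ y⟫_ℝ / ⟪grad Φ y, grad Φ y⟫_ℝ)) • grad Φ y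

/-- `a` satisfies the amplitude equation
`∂a/∂t + ∇_u a + ∇_a u = 2 (⟨∇_a u, ∇Φ⟩ / ⟨∇Φ, ∇Φ⟩) ∇Φ` wherever `∇Φ ≠ 0`. -/
def AmplitudeEqn (J : Set ℝ) (u : ℝ → ∀ x : M, T x) (Φ : ℝ → M → ℝ) (a : ℝ → ∀ x : M, T x) :
    Prop :=
  ∀ t y, (t, y) ∈ regularSet J Φ →
    derivWithin (fun s => a s y) J t + covDeriv (a t) y (u t y) + covDeriv (u t) y (a t y)
      = amplitudeForce (u t) (Φ t) y (a t y)

/-- The ODE along the Lagrangian path `t ↦ η(t, x)`, for a vector field `α` along that path: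
`Dα/dt + ∇_α u = 2 (⟨∇_α u, ∇Φ⟩ / ⟨∇Φ, ∇Φ⟩) ∇Φ` and `⟨α, ∇Φ⟩ ≡ 0`. -/
def RightODE (J : Set ℝ) (u : ℝ → ∀ x : M, T x) (η : ℝ → M ≃ₘ⟮𝓡 3, 𝓡 3⟯ M) (Φ : ℝ → M → ℝ)
    (x : M) (α : ∀ t : ℝ, T (η t x)) : Prop :=
  ∀ t ∈ J,
    HasCovDerivAlong J (fun s => η s x) α t
      (amplitudeForce (u t) (Φ t) (η t x) (α t) - covDeriv (u t) (η t x) (α t)) ∧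
    ⟪α t, grad (Φ t) (η t x)⟫_ℝ = 0

/-- The ODE in the fixed tangent space `T_x M`:
`d/dt (π_{ξ^⊥} Λ(t) β(t)) + (⟨ξ, w⟩ / ⟨ξ, ξ⟩) ξ × β(t) = 0` and `⟨β, ξ⟩ ≡ 0`. -/
def LeftODE (J : Set ℝ) (η : ℝ → M ≃ₘ⟮𝓡 3, 𝓡 3⟯ M) (x : M) (o : Orientation ℝ (T x) (Fin 3))
    (ξ w : T x) (β : ℝ → T x) : Prop :=
  ∀ t ∈ J,
    HasDerivWithinAt (fun s => projPerp ξ (deformation (η s) x (β s)))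
      (-((⟪ξ, w⟫_ℝ / ⟪ξ, ξ⟫_ℝ) • cross o ξ (β t))) J t ∧
    ⟪β t, ξ⟫_ℝ = 0

end Geometry

end WKB

/-! The derivative of `t ↦ Φ(t, η(t, x))` is the left side of the phase equation, so the phase is
constant along the flow: `Φ₀ = Φ(t) ∘ η(t)`. Hence `⟨Dη v, ∇Φ⟩ = ⟨v, ∇Φ₀⟩`, and `Dη` carries `ξ^⊥`
onto `∇Φ^⊥`, where `ξ = ∇Φ₀(x)`.

Along a path of the flow the amplitude equation is an ODE, because `∂ₜa + ∇_u a` is the covariant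
derivative of `α(t) = a(t, η(t, x))`. Write `α = Dη β`. Symmetry of second covariant derivatives
gives `D/dt (Dη w) = ∇_{Dη w} u` (`IsFlow.hasCovDerivAlong_D`), so `Dη β' = Dα/dt - ∇_α u` and `d/dt
⟨β, ξ⟩ = ⟨Dα/dt - ∇_α u, ∇Φ⟩`. The factor 2 in the amplitude equation is exactly what makes this
vanish, so orthogonality at time 0 persists.

For `w ⟂ ξ`, `d/dt ⟨Λβ, w⟩ = d/dt ⟨α, Dη w⟩ = ⟨Dα/dt, Dη w⟩ + ⟨α, ∇_{Dη w} u⟩`. Conservation of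
vorticity (`IsEulerSolution.vorticity_conservation`) exchanges the last term for `⟨∇_α u, Dη w⟩` at
the cost of an initial curl term, of which only the component along `ξ` is seen by vectors
orthogonal to `ξ`. So the projected equation says that `Dα/dt + ∇_α u` is a multiple of `∇Φ`, and
the differentiated constraint `⟨β, ξ⟩ = 0` determines the multiple.

Vorticity is conserved because the Euler equation makes the acceleration of the flow a gradient: the
time derivative of the pulled back one-form `η^* u^♭` is exact, and the exterior derivative kills
it. -/

namespace WKB

set_option linter.unusedSectionVars false

/-! ### The Levi-Civita connection in a preferred chart -/

section LocalGeometry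

open Filter Topology

variable {M : Type*} [TopologicalSpace M] [ChartedSpace E3 M] [IsManifold (𝓡 3) ∞ M]

lemma coords_self (p : M) : coords p p = ContinuousLinearMap.id ℝ E3 :=
  mfderiv_extChartAt_self

lemma coords_self_apply (p : M) (v : T p) : coords p p v = v := by
  rw [coords_self]; rfl

lemma coordVec_coords (p : M) {y : E3} (hy : y ∈ (extChartAt (𝓡 3) p).target)
    (v : T ((extChartAt (𝓡 3) p).symm y)) :
    coordVec p y (coords p ((extChartAt (𝓡 3) p).symm y) v) = v := by
  have h := mfderivWithin_extChartAt_symm_comp_mfderiv_extChartAt (I := 𝓡 3) hy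
  rw [ModelWithCorners.range_eq_univ, mfderivWithin_univ] at h
  exact congr($h v)

/-- A coordinate field is the tangent map of the inverse chart applied to a constant section. -/
lemma contMDiffOn_coordVec (p : M) (b : E3) :
    ContMDiffOn 𝓘(ℝ, E3) (𝓡 3).tangent ∞
      (fun y => (⟨(extChartAt (𝓡 3) p).symm y, coordVec p y b⟩ : TangentBundle (𝓡 3) M))
      (extChartAt (𝓡 3) p).target := by
  have h1 : ContMDiffOn 𝓘(ℝ, E3) (𝓡 3) ∞ (extChartAt (𝓡 3) p).symm
      (extChartAt (𝓡 3) p).target := contMDiffOn_extChartAt_symm p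
  have ho : IsOpen (extChartAt (𝓡 3) p).target := isOpen_extChartAt_target p
  have h2 := h1.contMDiffOn_tangentMapWithin (m := ∞) (by simp) ho.uniqueMDiffOn
  have h3 : ContMDiff 𝓘(ℝ, E3) 𝓘(ℝ, E3).tangent ∞
      (fun y => (⟨y, b⟩ : TangentBundle 𝓘(ℝ, E3) E3)) :=
    contMDiff_vectorSpace_iff_contDiff.2 contDiff_const
  refine (h2.comp h3.contMDiffOn (fun y hy => hy)).congr fun y hy => ?_
  simp only [Function.comp, tangentMapWithin, coordVec]
  rw [mfderivWithin_of_isOpen ho hy]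
  rfl

variable [RiemannianBundle (fun x : M => TangentSpace (𝓡 3) x)]

lemma inner_eq_metricCoeff (p : M) {q : M} (hq : q ∈ (extChartAt (𝓡 3) p).source) (v w : T q) :
    ⟪v, w⟫_ℝ = metricCoeff p (coords p q v) (coords p q w) (extChartAt (𝓡 3) p q) := by
  obtain ⟨y, hy, rfl⟩ : ∃ y ∈ (extChartAt (𝓡 3) p).target, (extChartAt (𝓡 3) p).symm y = q :=
    ⟨_, (extChartAt (𝓡 3) p).map_source hq, (extChartAt (𝓡 3) p).left_inv hq⟩
  rw [(extChartAt (𝓡 3) p).right_inv hy, metricCoeff, coordVec_coords p hy, coordVec_coords p hy]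

lemma metricCoeff_comm (p : M) (b c : E3) : metricCoeff p b c = metricCoeff p c b := by
  ext y; exact real_inner_comm _ _

/-- Isolates the dependence on `y` in the nine functions `g_ij`. This yields the linearity of
`metricDeriv` in its last two arguments and allows inner products to be differentiated term by term.
-/
lemma metricCoeff_eq_sum (p : M) (b c y : E3) :
    metricCoeff p b c y = ∑ i, ∑ j, b i * (c j *
      metricCoeff p (EuclideanSpace.single i 1) (EuclideanSpace.single j 1) y) := by
  have key : ∀ b : E3, b = ∑ i, b i • EuclideanSpace.single i (1 : ℝ) := fun b => by
    ext j; simp [Pi.single_apply]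
  have hb : coordVec p y b = ∑ i, b i • coordVec p y (EuclideanSpace.single i 1) := by
    conv_lhs => rw [key b]
    simp only [map_sum, map_smul]
  have hc : coordVec p y c = ∑ i, c i • coordVec p y (EuclideanSpace.single i 1) := by
    conv_lhs => rw [key c]
    simp only [map_sum, map_smul]
  simp only [metricCoeff]
  rw [hb, hc]
  simp only [sum_inner, inner_sum, inner_smul_left, inner_smul_right, RCLike.conj_to_real,
    Finset.mul_sum]
  rw [Finset.sum_comm]
  exact Finset.sum_congr rfl fun i _ => Finset.sum_congr rfl fun j _ => by ring

variable [IsContMDiffRiemannianBundle (𝓡 3) ∞ E3 (fun x : M => TangentSpace (𝓡 3) x)]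

lemma contDiffOn_metricCoeff (p : M) (b c : E3) :
    ContDiffOn ℝ ∞ (metricCoeff p b c) (extChartAt (𝓡 3) p).target := by
  rw [← contMDiffOn_iff_contDiffOn]
  exact ContMDiffOn.inner_bundle (IB := 𝓡 3) (contMDiffOn_coordVec p b) (contMDiffOn_coordVec p c)

lemma differentiableAt_metricCoeff (p : M) (b c : E3) :
    DifferentiableAt ℝ (metricCoeff p b c) (extChartAt (𝓡 3) p p) :=
  ((contDiffOn_metricCoeff p b c).contDiffAt (extChartAt_target_mem_nhds p)).differentiableAt
    (by simp)

lemma metricDeriv_comm (p : M) (a b c : E3) : metricDeriv p a b c = metricDeriv p a c b := by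
  simp only [metricDeriv, metricCoeff_comm p b c]

lemma metricDeriv_eq_sum (p : M) (a b c : E3) :
    metricDeriv p a b c = ∑ i, ∑ j, b i * (c j *
      metricDeriv p a (EuclideanSpace.single i 1) (EuclideanSpace.single j 1)) := by
  have h : metricCoeff p b c = fun y => ∑ i, ∑ j, b i * (c j *
      metricCoeff p (EuclideanSpace.single i 1) (EuclideanSpace.single j 1) y) :=
    funext (metricCoeff_eq_sum p b c)
  have h2 := HasFDerivAt.fun_sum (u := Finset.univ) fun i _ =>
    HasFDerivAt.fun_sum (u := Finset.univ) fun j _ =>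
      ((differentiableAt_metricCoeff p (EuclideanSpace.single i 1)
        (EuclideanSpace.single j 1)).hasFDerivAt.const_mul (c j)).const_mul (b i)
  rw [metricDeriv, h, h2.fderiv]
  simp [metricDeriv]

lemma metricDeriv_add_right (p : M) (a b c c' : E3) :
    metricDeriv p a b (c + c') = metricDeriv p a b c + metricDeriv p a b c' := by
  rw [metricDeriv_eq_sum p a b c, metricDeriv_eq_sum p a b c', metricDeriv_eq_sum p a b (c + c')]
  simp only [← Finset.sum_add_distrib, WithLp.ofLp_add, Pi.add_apply]
  exact Finset.sum_congr rfl fun i _ => Finset.sum_congr rfl fun j _ => by ring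

lemma metricDeriv_smul_right (p : M) (a b c : E3) (r : ℝ) :
    metricDeriv p a b (r • c) = r * metricDeriv p a b c := by
  rw [metricDeriv_eq_sum p a b c, metricDeriv_eq_sum p a b (r • c)]
  simp only [Finset.mul_sum, WithLp.ofLp_smul, Pi.smul_apply, smul_eq_mul]
  exact Finset.sum_congr rfl fun i _ => Finset.sum_congr rfl fun j _ => by ring

lemma metricDeriv_add_left (p : M) (a a' b c : E3) :
    metricDeriv p (a + a') b c = metricDeriv p a b c + metricDeriv p a' b c := by
  simp [metricDeriv]

lemma metricDeriv_smul_left (p : M) (a b c : E3) (r : ℝ) :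
    metricDeriv p (r • a) b c = r * metricDeriv p a b c := by
  simp [metricDeriv]

lemma metricDeriv_add_middle (p : M) (a b b' c : E3) :
    metricDeriv p a (b + b') c = metricDeriv p a b c + metricDeriv p a b' c := by
  rw [metricDeriv_comm, metricDeriv_add_right, metricDeriv_comm p a c b, metricDeriv_comm p a c b']

lemma metricDeriv_smul_middle (p : M) (a b c : E3) (r : ℝ) :
    metricDeriv p a (r • b) c = r * metricDeriv p a b c := by
  rw [metricDeriv_comm, metricDeriv_smul_right, metricDeriv_comm p a c b]

lemma metricDeriv_sum_smul (p : M) (a b : E3) {ι : Type*} [Fintype ι] (r : ι → ℝ) (e : ι → E3) :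
    metricDeriv p a b (∑ i, r i • e i) = ∑ i, r i * metricDeriv p a b (e i) := by
  let L : E3 →ₗ[ℝ] ℝ :=
    { toFun := metricDeriv p a b
      map_add' := metricDeriv_add_right p a b
      map_smul' := fun r c => metricDeriv_smul_right p a b c r }
  exact (map_sum L (fun i => r i • e i) Finset.univ).trans
    (Finset.sum_congr rfl fun i _ => metricDeriv_smul_right p a b (e i) (r i))

lemma metricDeriv_sum_smul_left (p : M) (b c : E3) {ι : Type*} [Fintype ι] (r : ι → ℝ)
    (e : ι → E3) :
    metricDeriv p (∑ i, r i • e i) b c = ∑ i, r i * metricDeriv p (e i) b c := by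
  simp [metricDeriv]

/-- The definition imposes this formula on an orthonormal basis only; both sides are linear in `c`.
-/
lemma inner_christoffel (p : M) (a b c : T p) :
    ⟪christoffel p a b, c⟫_ℝ =
      (metricDeriv p a b c + metricDeriv p b a c - metricDeriv p c a b) / 2 := by
  have hc : c = ∑ i, ⟪stdOrthonormalBasis ℝ (T p) i, c⟫_ℝ • stdOrthonormalBasis ℝ (T p) i :=
    ((stdOrthonormalBasis ℝ (T p)).sum_repr' c).symm
  have e1 := metricDeriv_sum_smul p a b (fun i => ⟪stdOrthonormalBasis ℝ (T p) i, c⟫_ℝ)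
    (fun i => stdOrthonormalBasis ℝ (T p) i)
  have e2 := metricDeriv_sum_smul p b a (fun i => ⟪stdOrthonormalBasis ℝ (T p) i, c⟫_ℝ)
    (fun i => stdOrthonormalBasis ℝ (T p) i)
  have e3 := metricDeriv_sum_smul_left p a b (fun i => ⟪stdOrthonormalBasis ℝ (T p) i, c⟫_ℝ)
    (fun i => stdOrthonormalBasis ℝ (T p) i)
  erw [← hc] at e1 e2 e3
  rw [e1, e2, e3, christoffel, sum_inner, ← Finset.sum_add_distrib, ← Finset.sum_sub_distrib,
    Finset.sum_div]
  refine Finset.sum_congr rfl fun i _ => ?_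
  rw [inner_smul_left, RCLike.conj_to_real]
  ring

/-- Absence of torsion, in a chart. -/
lemma christoffel_comm (p : M) (a b : T p) : christoffel p a b = christoffel p b a := by
  refine ext_inner_right ℝ fun c => ?_
  rw [inner_christoffel, inner_christoffel, metricDeriv_comm p c a b]
  ring

/-- Metric compatibility: in the sum of the two Koszul formulas the derivatives in the directions
`b` and `c` cancel. -/
lemma inner_christoffel_add (p : M) (a b c : T p) :
    ⟪christoffel p a b, c⟫_ℝ + ⟪b, christoffel p a c⟫_ℝ = metricDeriv p a b c := by
  rw [real_inner_comm (christoffel p a c) b, inner_christoffel, inner_christoffel,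
    metricDeriv_comm p a c b, metricDeriv_comm p b a c, metricDeriv_comm p c a b]
  ring

/-- The Christoffel map `a ↦ Γ(a, b)` as a continuous linear map. -/
noncomputable def christoffelL (p : M) (b : T p) : T p →L[ℝ] T p :=
  LinearMap.toContinuousLinearMap
    { toFun := fun a => christoffel p a b
      map_add' := fun a a' => ext_inner_right ℝ fun c => by
        rw [inner_add_left, inner_christoffel, inner_christoffel, inner_christoffel]
        have h1 := metricDeriv_add_left p a a' b c
        have h2 := metricDeriv_add_middle p b a a' c
        have h3 := metricDeriv_add_middle p c a a' b
        erw [h1, h2, h3]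
        ring
      map_smul' := fun r a => ext_inner_right ℝ fun c => by
        rw [inner_smul_left, inner_christoffel, inner_christoffel]
        have h1 := metricDeriv_smul_left p a b c r
        have h2 := metricDeriv_smul_middle p b a c r
        have h3 := metricDeriv_smul_middle p c a b r
        erw [h1, h2, h3]
        simp
        ring }

@[simp] lemma christoffelL_apply (p : M) (a b : T p) : christoffelL p b a = christoffel p a b := rfl

/-- Compatibility of the Levi-Civita connection with the metric, for two vector fields along a map
`G` from a normed space to `M`. -/
lemma hasFDerivWithinAt_inner_along {N : Type*} [NormedAddCommGroup N] [NormedSpace ℝ N]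
    {S : Set N} {n₀ : N} {G : N → M} {X Y : ∀ n, T (G n)} {G' X' Y' : N →L[ℝ] E3}
    (hG : ContinuousWithinAt G S n₀)
    (hG' : HasFDerivWithinAt (fun n => extChartAt (𝓡 3) (G n₀) (G n)) G' S n₀)
    (hX : HasFDerivWithinAt (fun n => coords (G n₀) (G n) (X n)) X' S n₀)
    (hY : HasFDerivWithinAt (fun n => coords (G n₀) (G n) (Y n)) Y' S n₀) (hn : n₀ ∈ S) :
    ∃ F' : N →L[ℝ] ℝ, HasFDerivWithinAt (fun n => ⟪X n, Y n⟫_ℝ) F' S n₀ ∧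
      ∀ ν, F' ν = ⟪(show T (G n₀) from X' ν) + christoffel (G n₀) (G' ν) (X n₀), Y n₀⟫_ℝ +
        ⟪X n₀, (show T (G n₀) from Y' ν) + christoffel (G n₀) (G' ν) (Y n₀)⟫_ℝ := by
  -- In the fixed chart at `G n₀` the inner product is a sum of products of components and `g_ij`,
  -- so the product rule applies.
  have hev : ∀ᶠ n in 𝓝[S] n₀, ⟪X n, Y n⟫_ℝ =
      ∑ i, ∑ j, (coords (G n₀) (G n) (X n)) i * ((coords (G n₀) (G n) (Y n)) j *
        metricCoeff (G n₀) (EuclideanSpace.single i 1) (EuclideanSpace.single j 1)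
          (extChartAt (𝓡 3) (G n₀) (G n))) := by
    filter_upwards [hG (extChartAt_source_mem_nhds (I := 𝓡 3) (G n₀))] with n hn
    rw [inner_eq_metricCoeff (G n₀) hn, metricCoeff_eq_sum]
  have hcoord : ∀ {Z : ∀ n, T (G n)} {Z' : N →L[ℝ] E3}
      (_ : HasFDerivWithinAt (fun n => coords (G n₀) (G n) (Z n)) Z' S n₀) (i : Fin 3),
      HasFDerivWithinAt (fun n => (coords (G n₀) (G n) (Z n)) i)
        ((EuclideanSpace.proj i : E3 →L[ℝ] ℝ).comp Z') S n₀ := fun hZ i =>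
    (EuclideanSpace.proj i : E3 →L[ℝ] ℝ).hasFDerivAt.comp_hasFDerivWithinAt n₀ hZ
  have hd := HasFDerivWithinAt.fun_sum (u := Finset.univ) fun (i : Fin 3) _ =>
    HasFDerivWithinAt.fun_sum (u := Finset.univ) fun (j : Fin 3) _ =>
      (hcoord hX i).mul ((hcoord hY j).mul
        ((differentiableAt_metricCoeff (G n₀) (EuclideanSpace.single i 1)
          (EuclideanSpace.single j 1)).hasFDerivAt.comp_hasFDerivWithinAt n₀ hG'))
  refine ⟨_, hd.congr_of_eventuallyEq hev (hev.self_of_nhdsWithin hn), fun ν => ?_⟩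
  rw [inner_add_left, inner_add_right]
  have h1 := inner_christoffel_add (G n₀) (G' ν) (X n₀) (Y n₀)
  have key : ∀ v w : T (G n₀), ⟪v, w⟫_ℝ = ∑ i, ∑ j, (show E3 from v) i * ((show E3 from w) j *
        metricCoeff (G n₀) (EuclideanSpace.single i 1) (EuclideanSpace.single j 1)
          (extChartAt (𝓡 3) (G n₀) (G n₀))) := fun v w => by
    rw [inner_eq_metricCoeff (G n₀) (mem_extChartAt_source (I := 𝓡 3) (G n₀)), metricCoeff_eq_sum,
      coords_self_apply, coords_self_apply]
  -- Regrouping that joins the two Christoffel terms into the derivative of the metric coefficients;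
  -- `c` is a dummy, filled with 0.
  have h2 : ∀ a b c d e f : ℝ, d + e = f → a + d + (b + e) = a + b + f := fun a b c d e f h => by
    linarith
  rw [h2 _ _ 0 _ _ _ h1, key, key]
  erw [metricDeriv_eq_sum]
  simp only [← Finset.sum_add_distrib, sum_apply]
  refine Finset.sum_congr rfl fun i _ => Finset.sum_congr rfl fun j _ => ?_
  have eX : coords (G n₀) (G n₀) (X n₀) = X n₀ := coords_self_apply _ _
  have eY : coords (G n₀) (G n₀) (Y n₀) = Y n₀ := coords_self_apply _ _
  simp [metricDeriv]
  rw [eX, eY]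
  ring

end LocalGeometry

/-! ### Covariant derivatives of vector fields along maps -/

section FieldsAlong

open Filter Topology

variable {M : Type*} [TopologicalSpace M] [ChartedSpace E3 M] [IsManifold (𝓡 3) ∞ M]

lemma hasMFDerivWithinAt_iff_extChartAt {N : Type*} [NormedAddCommGroup N] [NormedSpace ℝ N]
    {S : Set N} {n₀ : N} {G : N → M} {G' : N →L[ℝ] T (G n₀)} :
    HasMFDerivWithinAt 𝓘(ℝ, N) (𝓡 3) G S n₀ G' ↔ ContinuousWithinAt G S n₀ ∧
      HasFDerivWithinAt (fun n => extChartAt (𝓡 3) (G n₀) (G n)) (show N →L[ℝ] E3 from G') S n₀ := by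
  unfold HasMFDerivWithinAt
  simp only [writtenInExtChartAt, extChartAt_model_space_eq_id, PartialEquiv.refl_symm,
    PartialEquiv.refl_coe, preimage_id, modelWithCornersSelf_coe, range_id, inter_univ]
  rfl

variable [RiemannianBundle (fun x : M => TangentSpace (𝓡 3) x)]
variable [IsContMDiffRiemannianBundle (𝓡 3) ∞ E3 (fun x : M => TangentSpace (𝓡 3) x)]

/-- `HasCovDerivWithin S G X n₀ G' Z`: within `S`, the map `G` from a normed space to `M` has the
derivative `G'` at `n₀`, and the vector field `X` along `G` has the covariant derivative `Z`. -/
structure HasCovDerivWithin {N : Type*} [NormedAddCommGroup N] [NormedSpace ℝ N]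
    (S : Set N) (G : N → M) (X : ∀ n, T (G n)) (n₀ : N) (G' Z : N →L[ℝ] T (G n₀)) : Prop where
  base : HasMFDerivWithinAt 𝓘(ℝ, N) (𝓡 3) G S n₀ G'
  field : HasFDerivWithinAt (fun n => coords (G n₀) (G n) (X n))
    (show N →L[ℝ] E3 from Z - (christoffelL (G n₀) (X n₀)).comp G') S n₀

section

variable {N : Type*} [NormedAddCommGroup N] [NormedSpace ℝ N] {S : Set N} {n₀ : N} {G : N → M}
  {G' : N →L[ℝ] T (G n₀)}

lemma HasCovDerivWithin.inner {X Y : ∀ n, T (G n)} {Z W : N →L[ℝ] T (G n₀)}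
    (hX : HasCovDerivWithin S G X n₀ G' Z) (hY : HasCovDerivWithin S G Y n₀ G' W) (hn : n₀ ∈ S) :
    ∃ F' : N →L[ℝ] ℝ, HasFDerivWithinAt (fun n => ⟪X n, Y n⟫_ℝ) F' S n₀ ∧
      ∀ ν, F' ν = ⟪Z ν, Y n₀⟫_ℝ + ⟪X n₀, W ν⟫_ℝ := by
  have hb := hasMFDerivWithinAt_iff_extChartAt.1 hX.base
  obtain ⟨F', h1, h2⟩ := hasFDerivWithinAt_inner_along hb.1 hb.2 hX.field hY.field hn
  refine ⟨F', h1, fun ν => ?_⟩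
  rw [h2 ν]
  congr 2
  · exact sub_add_cancel (Z ν) _
  · exact sub_add_cancel (W ν) _

lemma HasCovDerivWithin.comp {N' : Type*} [NormedAddCommGroup N'] [NormedSpace ℝ N'] {S' : Set N'}
    {m₀ : N'} {f : N' → N} {f' : N' →L[ℝ] N} {G' Z : N →L[ℝ] T (G (f m₀))} {X : ∀ n, T (G n)}
    (hX : HasCovDerivWithin S G X (f m₀) G' Z) (hf : HasFDerivWithinAt f f' S' m₀)
    (hm : MapsTo f S' S) :
    HasCovDerivWithin S' (fun m => G (f m)) (fun m => X (f m)) m₀ (G'.comp f') (Z.comp f') where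
  base := by
    have hb := hasMFDerivWithinAt_iff_extChartAt.1 hX.base
    exact hasMFDerivWithinAt_iff_extChartAt.2
      ⟨hb.1.comp hf.continuousWithinAt hm, hb.2.comp m₀ hf hm⟩
  field := hX.field.comp m₀ hf hm

lemma HasCovDerivWithin.congr {X Y : ∀ n, T (G n)} {Z : N →L[ℝ] T (G n₀)}
    (hX : HasCovDerivWithin S G X n₀ G' Z) (hn : n₀ ∈ S) (h : ∀ n ∈ S, Y n = X n) :
    HasCovDerivWithin S G Y n₀ G' Z where
  base := hX.base
  field := by
    rw [h n₀ hn]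
    exact hX.field.congr (fun n hn => by rw [h n hn]) (by rw [h n₀ hn])

lemma HasCovDerivWithin.unique {X : ∀ n, T (G n)} {Z Z' : N →L[ℝ] T (G n₀)}
    (hX : HasCovDerivWithin S G X n₀ G' Z) (hX' : HasCovDerivWithin S G X n₀ G' Z')
    (hS : UniqueDiffWithinAt ℝ S n₀) : Z = Z' :=
  sub_left_injective (hS.eq hX.field hX'.field)

/-- In the chart at `G n₀`, `Z ν μ = D²g(μ, ν) + Γ(G'μ, G'ν)`. Both terms are symmetric, the first
by Schwarz and the second by absence of torsion. Schwarz within `S` at a possible boundary point is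
the reason for `n₀ ∈ closure (interior S)`. -/
lemma exists_hasCovDerivWithin_mfderivWithin (hS : UniqueDiffOn ℝ S)
    (hS' : n₀ ∈ closure (interior S)) (hn : n₀ ∈ S) (hG : ContMDiffOn 𝓘(ℝ, N) (𝓡 3) ∞ G S) :
    ∃ Z : N → (N →L[ℝ] T (G n₀)), (∀ ν, HasCovDerivWithin S G
        (fun n => mfderivWithin 𝓘(ℝ, N) (𝓡 3) G S n ν) n₀
        (mfderivWithin 𝓘(ℝ, N) (𝓡 3) G S n₀) (Z ν)) ∧
      ∀ μ ν, Z μ ν = Z ν μ := by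
  set g : N → E3 := fun n => extChartAt (𝓡 3) (G n₀) (G n) with hg
  have hGd : ∀ n ∈ S, MDifferentiableWithinAt 𝓘(ℝ, N) (𝓡 3) G S n := fun n hn =>
    (hG n hn).mdifferentiableWithinAt (by simp)
  have hb := hasMFDerivWithinAt_iff_extChartAt.1 (hGd n₀ hn).hasMFDerivWithinAt
  have hgc : ContDiffWithinAt ℝ ∞ g S n₀ := by
    rw [← contMDiffWithinAt_iff_contDiffWithinAt]
    exact (contMDiffAt_extChartAt (I := 𝓡 3) (x := G n₀)).comp_contMDiffWithinAt n₀ (hG n₀ hn)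
  have hev : ∀ᶠ n in 𝓝[S] n₀, ∀ ν, coords (G n₀) (G n) (mfderivWithin 𝓘(ℝ, N) (𝓡 3) G S n ν) =
      fderivWithin ℝ g S n ν := by
    filter_upwards [hb.1 (extChartAt_source_mem_nhds (I := 𝓡 3) (G n₀)), self_mem_nhdsWithin]
      with n h1 h2 ν
    have h3 : MDifferentiableAt (𝓡 3) 𝓘(ℝ, E3) (extChartAt (𝓡 3) (G n₀)) (G n) :=
      mdifferentiableAt_extChartAt (by simpa using h1)
    have := mfderiv_comp_mfderivWithin n h3 (hGd n h2) (hS.uniqueMDiffOn n h2)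
    rw [← mfderivWithin_eq_fderivWithin]
    exact congr($this.symm ν)
  have hD : DifferentiableWithinAt ℝ (fderivWithin ℝ g S) S n₀ :=
    (hgc.fderivWithin_right (m := 1) hS
      (by rw [one_add_one_eq_two]; exact ENat.LEInfty.out) hn).differentiableWithinAt (by simp)
  have hG' : fderivWithin ℝ g S n₀ = mfderivWithin 𝓘(ℝ, N) (𝓡 3) G S n₀ :=
    hb.2.fderivWithin (hS n₀ hn)
  have hsymm : IsSymmSndFDerivWithinAt ℝ g S n₀ :=
    hgc.isSymmSndFDerivWithinAt (by simpa using (ENat.LEInfty.out : (2 : ℕ∞ω) ≤ ∞)) hS hS' hn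
  refine ⟨fun ν => (show N →L[ℝ] T (G n₀) from
      (ContinuousLinearMap.apply ℝ E3 ν).comp (fderivWithin ℝ (fderivWithin ℝ g S) S n₀)) +
      (christoffelL (G n₀) (mfderivWithin 𝓘(ℝ, N) (𝓡 3) G S n₀ ν)).comp
        (show N →L[ℝ] T (G n₀) from mfderivWithin 𝓘(ℝ, N) (𝓡 3) G S n₀), fun ν => ⟨(hGd n₀ hn).hasMFDerivWithinAt, ?_⟩,
      fun μ ν => ?_⟩
  · have h1 : HasFDerivWithinAt (fun n => fderivWithin ℝ g S n ν)
        ((ContinuousLinearMap.apply ℝ E3 ν).comp (fderivWithin ℝ (fderivWithin ℝ g S) S n₀))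
        S n₀ :=
      (ContinuousLinearMap.apply ℝ E3 ν).hasFDerivAt.comp_hasFDerivWithinAt n₀ hD.hasFDerivWithinAt
    refine (h1.congr_of_eventuallyEq (hev.mono fun n h => h ν)
      (hev.self_of_nhdsWithin hn ν)).congr_fderiv ?_
    exact (add_sub_cancel_right _ _).symm
  · have h1 := hsymm ν μ
    exact congr_arg₂ (fun a b : T (G n₀) => a + b) h1 (christoffel_comm _ _ _)

end

/-- The coordinate expression of a time-dependent vector field is differentiable, and its
derivative combines the time derivative with the covariant derivative. -/
lemma exists_hasFDerivWithinAt_coords {J : Set ℝ} {Y : ℝ → ∀ x : M, T x} {t : ℝ} {p : M} (ht : t ∈ J)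
    (hY : ContMDiffWithinAt (𝓘(ℝ, ℝ).prod (𝓡 3)) (𝓡 3).tangent 1
      (fun q : ℝ × M => (⟨q.2, Y q.1 q.2⟩ : TangentBundle (𝓡 3) M)) (J ×ˢ univ) (t, p)) :
    ∃ A' : ℝ × E3 →L[ℝ] T p,
      HasFDerivWithinAt (fun m : ℝ × E3 => coords p ((extChartAt (𝓡 3) p).symm m.2)
        (Y m.1 ((extChartAt (𝓡 3) p).symm m.2))) (show ℝ × E3 →L[ℝ] E3 from A') (J ×ˢ univ)
        (t, extChartAt (𝓡 3) p p) ∧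
      HasDerivWithinAt (fun s => Y s p) (A' (1, 0)) J t ∧
      ∀ v : T p, A' (0, v) = covDeriv (Y t) p v - christoffel p v (Y t p) := by
  set z : E3 := extChartAt (𝓡 3) p p with hz
  have hzp : (extChartAt (𝓡 3) p).symm z = p := extChartAt_to_inv p
  have hsymm : ContMDiffAt 𝓘(ℝ, E3) (𝓡 3) 1 (extChartAt (𝓡 3) p).symm z :=
    ((contMDiffOn_extChartAt_symm p).contMDiffAt (extChartAt_target_mem_nhds p))
  have hψ : ContMDiffAt 𝓘(ℝ, ℝ × E3) (𝓘(ℝ, ℝ).prod (𝓡 3)) 1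
      (fun m : ℝ × E3 => (m.1, (extChartAt (𝓡 3) p).symm m.2)) (t, z) :=
    ContMDiffAt.prodMk (contMDiffAt_iff_contDiffAt.2 contDiffAt_fst)
      (hsymm.comp (t, z) (contMDiffAt_iff_contDiffAt.2 contDiffAt_snd))
  have hcomp : ContMDiffWithinAt 𝓘(ℝ, ℝ × E3) (𝓡 3).tangent 1
      (fun m : ℝ × E3 => (⟨(extChartAt (𝓡 3) p).symm m.2,
        Y m.1 ((extChartAt (𝓡 3) p).symm m.2)⟩ : TangentBundle (𝓡 3) M)) (J ×ˢ univ) (t, z) := by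
    refine ContMDiffWithinAt.comp (t, z)
      (g := fun q : ℝ × M => (⟨q.2, Y q.1 q.2⟩ : TangentBundle (𝓡 3) M))
      (t := J ×ˢ univ) ?_ hψ.contMDiffWithinAt (fun m hm => ⟨hm.1, mem_univ _⟩)
    simpa only [hzp] using hY
  have hzs : (extChartAt (𝓡 3) p).symm z ∈ (chartAt E3 p).source := by
    rw [hzp]; exact mem_chart_source E3 p
  have hd := ((trivializationAt E3 (TangentSpace (𝓡 3)) p).contMDiffWithinAt_iff
    (by simpa using hzs)).1 hcomp |>.2
  rw [contMDiffWithinAt_iff_contDiffWithinAt] at hd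
  have hmem : (t, z) ∈ J ×ˢ (univ : Set E3) := ⟨ht, mem_univ _⟩
  -- Over the chart domain `coords p` is the trivialization of the tangent bundle at `p`, in which
  -- smoothness of a section is expressed.
  have hev : ∀ᶠ m : ℝ × E3 in 𝓝[J ×ˢ univ] (t, z), coords p ((extChartAt (𝓡 3) p).symm m.2)
        (Y m.1 ((extChartAt (𝓡 3) p).symm m.2)) =
      (trivializationAt E3 (TangentSpace (𝓡 3)) p (⟨(extChartAt (𝓡 3) p).symm m.2,
        Y m.1 ((extChartAt (𝓡 3) p).symm m.2)⟩ : TangentBundle (𝓡 3) M)).2 := by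
    have h1 : ∀ᶠ m : ℝ × E3 in 𝓝[J ×ˢ univ] (t, z), m.2 ∈ (extChartAt (𝓡 3) p).target :=
      ((continuous_snd.tendsto (t, z)).mono_left nhdsWithin_le_nhds).eventually
        (extChartAt_target_mem_nhds (I := 𝓡 3) p)
    filter_upwards [h1] with m hm
    have h2 := (extChartAt (𝓡 3) p).map_target hm
    rw [extChartAt_source] at h2
    rw [coords, ← TangentBundle.continuousLinearMapAt_trivializationAt h2]
    exact Bundle.Trivialization.continuousLinearMapAt_apply_of_mem _ _ (by simpa using h2) _
  have hA := ((hd.differentiableWithinAt one_ne_zero).congr_of_eventuallyEq hev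
    (hev.self_of_nhdsWithin hmem)).hasFDerivWithinAt
  refine ⟨fderivWithin ℝ (fun m : ℝ × E3 => coords p ((extChartAt (𝓡 3) p).symm m.2)
        (Y m.1 ((extChartAt (𝓡 3) p).symm m.2))) (J ×ˢ univ) (t, z), hA, ?_, fun v => ?_⟩
  · have h1 : HasDerivWithinAt (fun s : ℝ => (s, z)) ((1 : ℝ), (0 : E3)) J t :=
      (hasDerivWithinAt_id t J).prodMk (hasDerivWithinAt_const t J z)
    have h2 := hA.comp_hasDerivWithinAt t h1 (fun s hs => mk_mem_prod hs (mem_univ _))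
    -- The type of `Y s q` depends on `q`, so the base point is made a variable before the equality
    -- is substituted.
    have h3 : ∀ s, ∀ q : M, q = p → coords p q (Y s q) = Y s p := by
      rintro s _ rfl; exact coords_self_apply _ _
    exact h2.congr (fun s _ => (h3 s _ hzp).symm) (h3 t _ hzp).symm
  · have h1 : HasFDerivAt (fun y : E3 => (t, y)) (ContinuousLinearMap.inr ℝ ℝ E3) z :=
      hasFDerivAt_prodMk_right t z
    have h2 := hA.comp z h1.hasFDerivWithinAt (fun y (_ : y ∈ univ) => ⟨ht, mem_univ _⟩)
    rw [hasFDerivWithinAt_univ] at h2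
    have h3 := h2.fderiv
    refine eq_sub_of_add_eq ?_
    rw [covDeriv, ← hz]
    congr 1
    exact congr($h3.symm v)

/-- Chain rule: the coordinate expression of `Y` is composed with `(τ, G)`, and its derivative at
`(τ' ν, G' ν)` splits into a time part and a space part. -/
lemma exists_hasCovDerivWithin_of_contMDiffWithinAt {N : Type*} [NormedAddCommGroup N]
    [NormedSpace ℝ N] {S : Set N} {n₀ : N} {G : N → M} {G' : N →L[ℝ] T (G n₀)}
    {τ : N → ℝ} {τ' : N →L[ℝ] ℝ} {J : Set ℝ} {Y : ℝ → ∀ x : M, T x}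
    (hJ : UniqueDiffWithinAt ℝ J (τ n₀)) (hn : n₀ ∈ S) (hτ : HasFDerivWithinAt τ τ' S n₀)
    (hm : MapsTo τ S J)
    (hG : HasMFDerivWithinAt 𝓘(ℝ, N) (𝓡 3) G S n₀ G')
    (hY : ContMDiffWithinAt (𝓘(ℝ, ℝ).prod (𝓡 3)) (𝓡 3).tangent 1
      (fun q : ℝ × M => (⟨q.2, Y q.1 q.2⟩ : TangentBundle (𝓡 3) M)) (J ×ˢ univ) (τ n₀, G n₀)) :
    ∃ Z : N →L[ℝ] T (G n₀), HasCovDerivWithin S G (fun n => Y (τ n) (G n)) n₀ G' Z ∧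
      ∀ ν, Z ν = τ' ν • derivWithin (fun s => Y s (G n₀)) J (τ n₀) +
        covDeriv (Y (τ n₀)) (G n₀) (G' ν) := by
  obtain ⟨A', h1, h2, h3⟩ := exists_hasFDerivWithinAt_coords (hm hn) hY
  have hb := hasMFDerivWithinAt_iff_extChartAt.1 hG
  have h4 := h1.comp n₀ (hτ.prodMk hb.2) (fun n hn => mk_mem_prod (hm hn) (mem_univ _))
  have hev : ∀ᶠ n in 𝓝[S] n₀, coords (G n₀) (G n) (Y (τ n) (G n)) =
      coords (G n₀) ((extChartAt (𝓡 3) (G n₀)).symm (extChartAt (𝓡 3) (G n₀) (G n)))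
        (Y (τ n) ((extChartAt (𝓡 3) (G n₀)).symm (extChartAt (𝓡 3) (G n₀) (G n)))) := by
    filter_upwards [hb.1 (extChartAt_source_mem_nhds (I := 𝓡 3) (G n₀))] with n hn
    rw [(extChartAt (𝓡 3) (G n₀)).left_inv hn]
  refine ⟨A'.comp (τ'.prod (show N →L[ℝ] E3 from G')) +
    (christoffelL (G n₀) (Y (τ n₀) (G n₀))).comp G', ⟨hG, ?_⟩, fun ν => ?_⟩
  · refine (h4.congr_of_eventuallyEq hev (hev.self_of_nhdsWithin hn)).congr_fderiv ?_
    exact (add_sub_cancel_right _ _).symm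
  · have h5 : A' (τ' ν, (show E3 from G' ν)) = τ' ν • A' (1, 0) + A' (0, G' ν) := by
      rw [← map_smul, ← map_add]
      exact congr_arg A' (Prod.ext (by simp)
        (by rw [Prod.snd_add, Prod.smul_snd, smul_zero]; exact (zero_add _).symm))
    have h6 := h2.derivWithin hJ
    calc A' (τ' ν, (show E3 from G' ν)) + christoffel (G n₀) (G' ν) (Y (τ n₀) (G n₀))
        = _ := by rw [h5, h6, h3, add_assoc, sub_add_cancel]

/-- `HasCovDerivAlong` leaves the velocity existential; unique differentiability forces it to be
`v`. -/
lemma hasCovDerivAlong_iff {J : Set ℝ} {γ : ℝ → M} {α : ∀ t : ℝ, T (γ t)} {t : ℝ} {Z : T (γ t)}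
    (hJ : UniqueDiffWithinAt ℝ J t) {v : T (γ t)}
    (hγ : HasMFDerivWithinAt 𝓘(ℝ, ℝ) (𝓡 3) γ J t (ContinuousLinearMap.toSpanSingleton ℝ v)) :
    HasCovDerivAlong J γ α t Z ↔ HasCovDerivWithin J γ α t
      (ContinuousLinearMap.toSpanSingleton ℝ v) (ContinuousLinearMap.toSpanSingleton ℝ Z) := by
  have key : HasDerivWithinAt (fun s => coords (γ t) (γ s) (α s))
      (Z - christoffel (γ t) v (α t)) J t ↔ HasFDerivWithinAt (fun s => coords (γ t) (γ s) (α s))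
    (show ℝ →L[ℝ] E3 from ContinuousLinearMap.toSpanSingleton ℝ Z -
      (christoffelL (γ t) (α t)).comp (ContinuousLinearMap.toSpanSingleton ℝ v)) J t := by
    refine hasDerivWithinAt_iff_hasFDerivWithinAt.trans ?_
    refine Iff.of_eq (congr_arg (fun L : ℝ →L[ℝ] E3 => HasFDerivWithinAt _ L J t) ?_)
    refine ContinuousLinearMap.ext_ring ?_
    have : christoffelL (γ t) (α t) ((1 : ℝ) • v) = christoffel (γ t) v (α t) := by
      rw [one_smul]; rfl
    refine (one_smul ℝ _).trans ?_
    refine congr_arg₂ (fun a b : T (γ t) => a - b) (one_smul ℝ Z).symm this.symm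
  constructor
  · rintro ⟨w, hw, h⟩
    have hwv : w = v := by
      have h1 := (hasMFDerivWithinAt_iff_extChartAt.1 hw).2.hasDerivWithinAt
      have h2 := (hasMFDerivWithinAt_iff_extChartAt.1 hγ).2.hasDerivWithinAt
      have h3 := hJ.eq_deriv _ h1 h2
      exact (one_smul ℝ w).symm.trans (h3.trans (one_smul ℝ v))
    subst hwv
    exact ⟨hγ, key.1 h⟩
  · exact fun h => ⟨v, hγ, key.2 h.field⟩

end FieldsAlong

/-! ### Calculus on a nondegenerate interval, endpoints included -/

section Interval

variable {J : Set ℝ}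

lemma nonempty_interior_of_ordConnected (hJ : J.OrdConnected) (hJ' : J.Nontrivial) :
    (interior J).Nonempty := by
  obtain ⟨a, ha, b, hb, hab⟩ := hJ'.exists_lt
  refine (nonempty_Ioo.2 hab).mono (interior_maximal ?_ isOpen_Ioo)
  exact Ioo_subset_Icc_self.trans (hJ.out ha hb)

lemma uniqueDiffOn_of_ordConnected (hJ : J.OrdConnected) (hJ' : J.Nontrivial) :
    UniqueDiffOn ℝ J :=
  uniqueDiffOn_convex hJ.convex (nonempty_interior_of_ordConnected hJ hJ')

lemma subset_closure_interior_of_ordConnected (hJ : J.OrdConnected) (hJ' : J.Nontrivial) :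
    J ⊆ closure (interior J) := by
  have hc : Convex ℝ J := hJ.convex
  rw [hc.closure_interior_eq_closure_of_nonempty_interior
    (nonempty_interior_of_ordConnected hJ hJ')]
  exact subset_closure

lemma eq_of_hasDerivWithinAt_zero (hJ : J.OrdConnected) (hJ' : J.Nontrivial) {f : ℝ → ℝ}
    (hf : ∀ t ∈ J, HasDerivWithinAt f 0 J t) {s t : ℝ} (hs : s ∈ J) (ht : t ∈ J) : f s = f t := by
  refine hJ.convex.is_const_of_fderivWithin_eq_zero (𝕜 := ℝ)
    (fun r hr => (hf r hr).differentiableWithinAt) (fun r hr => ?_) hs ht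
  rw [(hf r hr).hasFDerivWithinAt.fderivWithin (uniqueDiffOn_of_ordConnected hJ hJ' r hr)]
  simp

end Interval

/-! ### The flow in a chart and its linearization -/

section Flow

open Filter Topology

variable {M : Type*} [TopologicalSpace M] [ChartedSpace E3 M] [IsManifold (𝓡 3) ∞ M]

/-- The flow read in the preferred chart at `x` of the initial point. -/
noncomputable def chartFlow (η : ℝ → M ≃ₘ⟮𝓡 3, 𝓡 3⟯ M) (x : M) (m : ℝ × E3) : M :=
  η m.1 ((extChartAt (𝓡 3) x).symm m.2)

/-- The time interval times the target of the preferred chart at `x`. -/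
def chartCylinder (J : Set ℝ) (x : M) : Set (ℝ × E3) :=
  J ×ˢ (extChartAt (𝓡 3) x).target

/-- The derivative of `chartFlow`. -/
noncomputable def chartFlowDeriv (J : Set ℝ) (η : ℝ → M ≃ₘ⟮𝓡 3, 𝓡 3⟯ M) (x : M) (ν : ℝ × E3)
    (m : ℝ × E3) : T (chartFlow η x m) :=
  mfderivWithin 𝓘(ℝ, ℝ × E3) (𝓡 3) (chartFlow η x) (chartCylinder J x) m ν

variable {J : Set ℝ} {u : ℝ → ∀ x : M, T x} {η : ℝ → M ≃ₘ⟮𝓡 3, 𝓡 3⟯ M}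

lemma uniqueDiffOn_chartCylinder (hJ : J.OrdConnected) (hJ' : J.Nontrivial) (x : M) :
    UniqueDiffOn ℝ (chartCylinder J x) :=
  (uniqueDiffOn_of_ordConnected hJ hJ').prod (isOpen_extChartAt_target (I := 𝓡 3) x).uniqueDiffOn

lemma chartCylinder_subset_closure_interior (hJ : J.OrdConnected) (hJ' : J.Nontrivial) (x : M) :
    chartCylinder J x ⊆ closure (interior (chartCylinder J x)) := by
  rintro ⟨t, z⟩ ⟨ht, hz⟩
  rw [chartCylinder, interior_prod_eq, closure_prod_eq]
  refine ⟨subset_closure_interior_of_ordConnected hJ hJ' ht, subset_closure ?_⟩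
  rwa [(isOpen_extChartAt_target (I := 𝓡 3) x).interior_eq]

lemma hasMFDerivAt_D {e : M ≃ₘ⟮𝓡 3, 𝓡 3⟯ M} {x : M} : HasMFDerivAt (𝓡 3) (𝓡 3) e x (D e x) :=
  (e.mdifferentiable (by simp) x).hasMFDerivAt

variable [RiemannianBundle (fun x : M => TangentSpace (𝓡 3) x)]
variable [IsContMDiffRiemannianBundle (𝓡 3) ∞ E3 (fun x : M => TangentSpace (𝓡 3) x)]

lemma contMDiffOn_chartParam (J : Set ℝ) (x : M) :
    ContMDiffOn 𝓘(ℝ, ℝ × E3) (𝓘(ℝ, ℝ).prod (𝓡 3)) ∞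
      (fun m : ℝ × E3 => (m.1, (extChartAt (𝓡 3) x).symm m.2)) (chartCylinder J x) :=
  ContMDiffOn.prodMk (contMDiff_iff_contDiff.2 contDiff_fst).contMDiffOn
    ((contMDiffOn_extChartAt_symm x).comp (contMDiff_iff_contDiff.2 contDiff_snd).contMDiffOn
      (fun _ hm => hm.2))

lemma IsFlow.contMDiffOn_chartFlow (hη : IsFlow J u η) (x : M) :
    ContMDiffOn 𝓘(ℝ, ℝ × E3) (𝓡 3) ∞ (chartFlow η x) (chartCylinder J x) :=
  hη.smooth.comp (contMDiffOn_chartParam J x) (fun _ hm => mk_mem_prod hm.1 (mem_univ _))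

lemma IsFlow.hasMFDerivWithinAt_chartFlow (hη : IsFlow J u η) (x : M) {m : ℝ × E3}
    (hm : m ∈ chartCylinder J x) :
    HasMFDerivWithinAt 𝓘(ℝ, ℝ × E3) (𝓡 3) (chartFlow η x) (chartCylinder J x) m
      (mfderivWithin 𝓘(ℝ, ℝ × E3) (𝓡 3) (chartFlow η x) (chartCylinder J x) m) :=
  ((hη.contMDiffOn_chartFlow x m hm).mdifferentiableWithinAt (by simp)).hasMFDerivWithinAt

lemma IsFlow.chartFlowDeriv_time (hη : IsFlow J u η) (hJ : J.OrdConnected) (hJ' : J.Nontrivial)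
    (x : M) {m : ℝ × E3} (hm : m ∈ chartCylinder J x) :
    chartFlowDeriv J η x (1, 0) m = u m.1 (chartFlow η x m) := by
  have h1 : HasFDerivWithinAt (fun s : ℝ => (s, m.2)) (ContinuousLinearMap.inl ℝ ℝ E3) J m.1 :=
    (hasFDerivAt_prodMk_left m.1 m.2).hasFDerivWithinAt
  have h2 := HasMFDerivWithinAt.comp (I' := 𝓘(ℝ, ℝ × E3)) m.1
    (hη.hasMFDerivWithinAt_chartFlow x hm) h1.hasMFDerivWithinAt
    (fun s hs => mk_mem_prod hs hm.2)
  have h3 := hη.flow m.1 hm.1 ((extChartAt (𝓡 3) x).symm m.2)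
  have h4 := UniqueMDiffWithinAt.eq
    (uniqueDiffOn_of_ordConnected hJ hJ' m.1 hm.1).uniqueMDiffWithinAt h2 h3
  have h5 := congr($h4 (1 : ℝ))
  exact h5.trans (one_smul ℝ _)

lemma IsFlow.chartFlowDeriv_space (hη : IsFlow J u η) (x : M) {m : ℝ × E3}
    (hm : m ∈ chartCylinder J x) (w : E3) :
    chartFlowDeriv J η x (0, w) m =
      D (η m.1) ((extChartAt (𝓡 3) x).symm m.2) (coordVec x m.2 w) := by
  have ho : IsOpen (extChartAt (𝓡 3) x).target := isOpen_extChartAt_target x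
  have h1 : HasFDerivWithinAt (fun y : E3 => (m.1, y)) (ContinuousLinearMap.inr ℝ ℝ E3)
      (extChartAt (𝓡 3) x).target m.2 :=
    (hasFDerivAt_prodMk_right m.1 m.2).hasFDerivWithinAt
  have h2 := HasMFDerivWithinAt.comp (I' := 𝓘(ℝ, ℝ × E3)) m.2
    (hη.hasMFDerivWithinAt_chartFlow x hm) h1.hasMFDerivWithinAt
    (fun y hy => mk_mem_prod hm.1 hy)
  have h6 : MDifferentiableAt 𝓘(ℝ, E3) (𝓡 3) (extChartAt (𝓡 3) x).symm m.2 :=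
    ((contMDiffOn_extChartAt_symm (n := ∞) x).contMDiffAt (ho.mem_nhds hm.2)).mdifferentiableAt
      (by simp)
  have h3 := (HasMFDerivAt.comp m.2 (hasMFDerivAt_D (e := η m.1))
    h6.hasMFDerivAt).hasMFDerivWithinAt (s := (extChartAt (𝓡 3) x).target)
  have h4 := UniqueMDiffWithinAt.eq (ho.uniqueMDiffOn m.2 hm.2) h2 h3
  exact congr($h4 w)

/-- The field `∂ₜη` is `u` along the flow, so its covariant derivative is known in two ways: as a
second derivative of the flow, symmetric in its directions, and by the chain rule for `u`.
Uniqueness identifies the two. -/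
lemma IsFlow.exists_hasCovDerivWithin_chartFlowDeriv (hη : IsFlow J u η)
    (hu : ContMDiffOn (𝓘(ℝ, ℝ).prod (𝓡 3)) (𝓡 3).tangent ∞
      (fun p : ℝ × M => (⟨p.2, u p.1 p.2⟩ : TangentBundle (𝓡 3) M)) (J ×ˢ univ))
    (hJ : J.OrdConnected) (hJ' : J.Nontrivial) (x : M) {m : ℝ × E3} (hm : m ∈ chartCylinder J x) :
    ∃ Z : ℝ × E3 → (ℝ × E3 →L[ℝ] T (chartFlow η x m)),
      (∀ ν, HasCovDerivWithin (chartCylinder J x) (chartFlow η x) (chartFlowDeriv J η x ν) m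
        (mfderivWithin 𝓘(ℝ, ℝ × E3) (𝓡 3) (chartFlow η x) (chartCylinder J x) m) (Z ν)) ∧
      (∀ μ ν, Z μ ν = Z ν μ) ∧
      Z (1, 0) (1, 0) = derivWithin (fun s => u s (chartFlow η x m)) J m.1 +
        covDeriv (u m.1) (chartFlow η x m) (u m.1 (chartFlow η x m)) ∧
      ∀ w, Z (1, 0) (0, w) = covDeriv (u m.1) (chartFlow η x m) (chartFlowDeriv J η x (0, w) m) := by
  have hS := uniqueDiffOn_chartCylinder hJ hJ' x
  obtain ⟨Z, h1, h2⟩ := exists_hasCovDerivWithin_mfderivWithin hS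
    (chartCylinder_subset_closure_interior hJ hJ' x hm) hm (hη.contMDiffOn_chartFlow x)
  obtain ⟨W, h3, h4⟩ := exists_hasCovDerivWithin_of_contMDiffWithinAt
    (uniqueDiffOn_of_ordConnected hJ hJ' m.1 hm.1) hm hasFDerivWithinAt_fst (fun m hm => hm.1)
    (hη.hasMFDerivWithinAt_chartFlow x hm)
    ((hu (m.1, chartFlow η x m) (mk_mem_prod hm.1 (mem_univ _))).of_le (by simp))
  have h5 : Z (1, 0) = W := ((h1 (1, 0)).congr hm
    (fun n hn => (hη.chartFlowDeriv_time hJ hJ' x hn).symm)).unique h3 (hS m hm)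
  refine ⟨Z, h1, h2, ?_, fun w => ?_⟩
  · rw [h5, h4]
    refine congr_arg₂ (fun a b => a + b) (one_smul ℝ _) ?_
    rw [← hη.chartFlowDeriv_time hJ hJ' x hm]
    rfl
  · rw [h5, h4]
    exact (congr_arg (fun a => a + _) (zero_smul ℝ _)).trans (zero_add _)

/-- The covariant derivative of `Dη(t, x) w` along the path `t ↦ η(t, x)`. -/
lemma IsFlow.hasCovDerivAlong_D (hη : IsFlow J u η)
    (hu : ContMDiffOn (𝓘(ℝ, ℝ).prod (𝓡 3)) (𝓡 3).tangent ∞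
      (fun p : ℝ × M => (⟨p.2, u p.1 p.2⟩ : TangentBundle (𝓡 3) M)) (J ×ˢ univ))
    (hJ : J.OrdConnected) (hJ' : J.Nontrivial) (x : M) {t : ℝ} (ht : t ∈ J) (w : T x) :
    HasCovDerivAlong J (fun s => η s x) (fun s => D (η s) x w) t
      (covDeriv (u t) (η t x) (D (η t) x w)) := by
  have key : ∀ z ∈ (extChartAt (𝓡 3) x).target, ∀ w : E3,
      HasCovDerivAlong J (fun s => η s ((extChartAt (𝓡 3) x).symm z))
        (fun s => D (η s) ((extChartAt (𝓡 3) x).symm z) (coordVec x z w)) t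
        (covDeriv (u t) (η t ((extChartAt (𝓡 3) x).symm z))
          (D (η t) ((extChartAt (𝓡 3) x).symm z) (coordVec x z w))) := by
    intro z hz w
    have hm : (t, z) ∈ chartCylinder J x := ⟨ht, hz⟩
    obtain ⟨Z, h1, h2, -, h3⟩ := hη.exists_hasCovDerivWithin_chartFlowDeriv hu hJ hJ' x hm
    have hf : HasFDerivWithinAt (fun s : ℝ => (s, z)) (ContinuousLinearMap.inl ℝ ℝ E3) J t :=
      (hasFDerivAt_prodMk_left t z).hasFDerivWithinAt
    have h4 := (HasCovDerivWithin.comp (f := fun s : ℝ => (s, z)) (h1 (0, w)) hf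
      (fun s hs => mk_mem_prod hs hz)).congr ht
        (fun s hs => (hη.chartFlowDeriv_space x (m := (s, z)) ⟨hs, hz⟩ w).symm)
    rw [hasCovDerivAlong_iff (uniqueDiffOn_of_ordConnected hJ hJ' t ht) (hη.flow t ht _)]
    -- Symmetry exchanges `D/dt (∂_w η)` for `∇_w (∂ₜη)`, which is `∇_{Dη w} u`.
    have e1 : (Z (0, w)).comp (ContinuousLinearMap.inl ℝ ℝ E3) =
        ContinuousLinearMap.toSpanSingleton ℝ (covDeriv (u t) (η t ((extChartAt (𝓡 3) x).symm z))
          (D (η t) ((extChartAt (𝓡 3) x).symm z) (coordVec x z w))) := by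
      refine ContinuousLinearMap.ext_ring ?_
      refine ((h2 (0, w) (1, 0)).trans (h3 w)).trans (Eq.trans ?_ (one_smul ℝ _).symm)
      rw [hη.chartFlowDeriv_space x hm w]
      rfl
    rw [e1] at h4
    have e2 := UniqueMDiffWithinAt.eq
      (uniqueDiffOn_of_ordConnected hJ hJ' t ht).uniqueMDiffWithinAt h4.base (hη.flow t ht _)
    rw [e2] at h4
    exact h4
  -- Every point of the chart domain is `symm z` and every tangent vector there a `coordVec`; the
  -- variable `y` avoids rewriting in dependent types.
  have key2 : ∀ y : M, (∃ z ∈ (extChartAt (𝓡 3) x).target, (extChartAt (𝓡 3) x).symm z = y) →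
      ∀ w : T y, HasCovDerivAlong J (fun s => η s y) (fun s => D (η s) y w) t
        (covDeriv (u t) (η t y) (D (η t) y w)) := by
    rintro _ ⟨z, hz, rfl⟩ w
    have := key z hz (coords x _ w)
    rwa [coordVec_coords x hz] at this
  exact key2 x ⟨_, mem_extChartAt_target x, extChartAt_to_inv x⟩ w

end Flow

/-! ### Conservation of vorticity -/

section Vorticity

open Filter Topology

variable {M : Type*} [TopologicalSpace M] [ChartedSpace E3 M] [IsManifold (𝓡 3) ∞ M]
  [RiemannianBundle (fun x : M => TangentSpace (𝓡 3) x)]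
  [IsContMDiffRiemannianBundle (𝓡 3) ∞ E3 (fun x : M => TangentSpace (𝓡 3) x)]
  {J : Set ℝ} {u : ℝ → ∀ x : M, T x} {η : ℝ → M ≃ₘ⟮𝓡 3, 𝓡 3⟯ M}

lemma inner_grad (f : M → ℝ) (x : M) (v : T x) :
    ⟪grad f x, v⟫_ℝ = mfderiv (𝓡 3) 𝓘(ℝ, ℝ) f x v :=
  InnerProductSpace.toDual_symm_apply

lemma contMDiff_invLaplacian (g : M → ℝ) : ContMDiff (𝓡 3) 𝓘(ℝ, ℝ) ∞ (invLaplacian g) := by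
  unfold invLaplacian
  split_ifs with h
  · exact h.choose_spec.1
  · exact contMDiff_const

/-- All that matters about `leray` is that it subtracts the gradient of a smooth function. The
default value 0 of `invLaplacian` is smooth too, so solvability of the Poisson equation plays no
role. -/
lemma IsEulerSolution.exists_pressure (hu : IsEulerSolution J u) (t : ℝ) (ht : t ∈ J) :
    ∃ f : M → ℝ, ContMDiff (𝓡 3) 𝓘(ℝ, ℝ) ∞ f ∧ ∀ x,
      derivWithin (fun s => u s x) J t + covDeriv (u t) x (u t x) = grad f x := by
  refine ⟨invLaplacian (divergence fun y => covDeriv (u t) y (u t y)),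
    contMDiff_invLaplacian _, fun x => ?_⟩
  have := hu.euler t ht x
  rw [leray, ← add_sub_assoc, sub_eq_zero] at this
  exact this

lemma contMDiffOn_chartFlowDeriv (hη : IsFlow J u η) (hJ : J.OrdConnected) (hJ' : J.Nontrivial)
    (x : M) (ν : ℝ × E3) :
    ContMDiffOn 𝓘(ℝ, ℝ × E3) (𝓡 3).tangent ∞
      (fun m => (⟨chartFlow η x m, chartFlowDeriv J η x ν m⟩ : TangentBundle (𝓡 3) M))
      (chartCylinder J x) := by
  have h2 := (hη.contMDiffOn_chartFlow x).contMDiffOn_tangentMapWithin (m := ∞) (by simp)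
    (uniqueDiffOn_chartCylinder hJ hJ' x).uniqueMDiffOn
  have h3 : ContMDiff 𝓘(ℝ, ℝ × E3) 𝓘(ℝ, ℝ × E3).tangent ∞
      (fun y => (⟨y, ν⟩ : TangentBundle 𝓘(ℝ, ℝ × E3) (ℝ × E3))) :=
    contMDiff_vectorSpace_iff_contDiff.2 contDiff_const
  exact h2.comp h3.contMDiffOn (fun y hy => hy)

lemma contDiffOn_inner_chartFlowDeriv (hη : IsFlow J u η) (hJ : J.OrdConnected)
    (hJ' : J.Nontrivial) (x : M) (μ ν : ℝ × E3) :
    ContDiffOn ℝ ∞ (fun m => ⟪chartFlowDeriv J η x μ m, chartFlowDeriv J η x ν m⟫_ℝ)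
      (chartCylinder J x) := by
  rw [← contMDiffOn_iff_contDiffOn]
  exact ContMDiffOn.inner_bundle (IB := 𝓡 3) (contMDiffOn_chartFlowDeriv hη hJ hJ' x μ)
    (contMDiffOn_chartFlowDeriv hη hJ hJ' x ν)

/-- The pulled back velocity one-form satisfies `∂ₜ(η^* u^♭) = d((f + |u|² / 2) ∘ η)`. -/
lemma exists_fderivWithin_inner_chartFlowDeriv (hu : IsEulerSolution J u) (hη : IsFlow J u η)
    (hJ : J.OrdConnected) (hJ' : J.Nontrivial) (x : M) {t : ℝ} (ht : t ∈ J) :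
    ∃ E : E3 → ℝ, ContDiffOn ℝ ∞ E (extChartAt (𝓡 3) x).target ∧
      ∀ z ∈ (extChartAt (𝓡 3) x).target, ∀ w : E3,
        fderivWithin ℝ (fun m => ⟪chartFlowDeriv J η x (1, 0) m, chartFlowDeriv J η x (0, w) m⟫_ℝ)
          (chartCylinder J x) (t, z) (1, 0) = fderiv ℝ E z w := by
  obtain ⟨f, hf, hfe⟩ := hu.exists_pressure t ht
  have ho : IsOpen (extChartAt (𝓡 3) x).target := isOpen_extChartAt_target x
  have hι : ContDiff ℝ ∞ (fun y : E3 => (t, y)) := contDiff_const.prodMk contDiff_id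
  have hmaps : MapsTo (fun y : E3 => (t, y)) (extChartAt (𝓡 3) x).target (chartCylinder J x) :=
    fun y hy => mk_mem_prod ht hy
  have hGt : ContMDiffOn 𝓘(ℝ, E3) (𝓡 3) ∞ (fun y : E3 => chartFlow η x (t, y))
      (extChartAt (𝓡 3) x).target :=
    (hη.contMDiffOn_chartFlow x).comp (contMDiff_iff_contDiff.2 hι).contMDiffOn hmaps
  have hE1 : ContDiffOn ℝ ∞ (fun y : E3 => f (chartFlow η x (t, y)))
      (extChartAt (𝓡 3) x).target := by
    rw [← contMDiffOn_iff_contDiffOn]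
    exact hf.comp_contMDiffOn hGt
  have hE2 : ContDiffOn ℝ ∞ (fun y : E3 => ⟪chartFlowDeriv J η x (1, 0) (t, y),
      chartFlowDeriv J η x (1, 0) (t, y)⟫_ℝ) (extChartAt (𝓡 3) x).target :=
    (contDiffOn_inner_chartFlowDeriv hη hJ hJ' x (1, 0) (1, 0)).comp hι.contDiffOn hmaps
  refine ⟨fun y => f (chartFlow η x (t, y)) + (1 / 2) * ⟪chartFlowDeriv J η x (1, 0) (t, y),
      chartFlowDeriv J η x (1, 0) (t, y)⟫_ℝ, hE1.add (contDiffOn_const.mul hE2),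
      fun z hz w => ?_⟩
  have hm : (t, z) ∈ chartCylinder J x := ⟨ht, hz⟩
  have hS := uniqueDiffOn_chartCylinder hJ hJ' x (t, z) hm
  obtain ⟨Z, h1, h2, h3, h4⟩ := hη.exists_hasCovDerivWithin_chartFlowDeriv hu.smooth hJ hJ' x hm
  obtain ⟨A, hA, hA'⟩ := (h1 (1, 0)).inner (h1 (0, w)) hm
  obtain ⟨B, hB, hB'⟩ := (h1 (1, 0)).inner (h1 (1, 0)) hm
  have hι' : HasFDerivAt (fun y : E3 => (t, y)) (ContinuousLinearMap.inr ℝ ℝ E3) z :=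
    hasFDerivAt_prodMk_right t z
  have e2 : HasFDerivAt (fun y : E3 => ⟪chartFlowDeriv J η x (1, 0) (t, y),
      chartFlowDeriv J η x (1, 0) (t, y)⟫_ℝ) (B.comp (ContinuousLinearMap.inr ℝ ℝ E3)) z :=
    (hB.comp z hι'.hasFDerivWithinAt hmaps).hasFDerivAt (ho.mem_nhds hz)
  have hfd : HasMFDerivAt (𝓡 3) 𝓘(ℝ, ℝ) f (chartFlow η x (t, z))
      (mfderiv (𝓡 3) 𝓘(ℝ, ℝ) f (chartFlow η x (t, z))) :=
    (hf.mdifferentiable (by simp) _).hasMFDerivAt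
  have e1 := HasMFDerivWithinAt.comp (I' := 𝓘(ℝ, ℝ × E3)) z
    (hfd.comp_hasMFDerivWithinAt _ (hη.hasMFDerivWithinAt_chartFlow x hm))
    hι'.hasFDerivWithinAt.hasMFDerivWithinAt hmaps
  have e1' := (hasMFDerivWithinAt_iff_hasFDerivWithinAt.1 e1).hasFDerivAt (ho.mem_nhds hz)
  have e3 := (e1'.add (e2.const_mul (1 / 2))).fderiv
  rw [hA.fderivWithin hS, hA']
  refine Eq.trans ?_ congr($e3.symm w)
  -- `∂ₜ⟨∂ₜη, ∂_w η⟩` has two terms: the acceleration is `∇f`, which gives `∂_w (f ∘ η)`, and by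
  -- symmetry the other one is `⟨∂ₜη, ∇_w ∂ₜη⟩ = ∂_w |∂ₜη|² / 2`.
  have r1 : Z (0, w) (1, 0) = Z (1, 0) (0, w) := h2 _ _
  have r2 : Z (1, 0) (1, 0) = grad f (chartFlow η x (t, z)) := by rw [h3, hfe]
  rw [r1, r2, inner_grad]
  have r3 : B (0, w) = _ := hB' (0, w)
  rw [real_inner_comm] at r3
  have r4 : (1 / 2 : ℝ) * B (0, w) =
      ⟪chartFlowDeriv J η x (1, 0) (t, z), Z (1, 0) (0, w)⟫_ℝ := by
    rw [r3]; ring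
  rw [← r4]
  rfl

/-- The difference of derivatives of the components of the pulled back velocity one-form is
independent of time. -/
lemma curl_chart_const (hu : IsEulerSolution J u) (hη : IsFlow J u η)
    (hJ : J.OrdConnected) (hJ' : J.Nontrivial) (x : M) {z : E3}
    (hz : z ∈ (extChartAt (𝓡 3) x).target) (v w : E3) {s t : ℝ} (hs : s ∈ J) (ht : t ∈ J) :
    fderivWithin ℝ (fun m => ⟪chartFlowDeriv J η x (1, 0) m, chartFlowDeriv J η x (0, w) m⟫_ℝ)
          (chartCylinder J x) (s, z) (0, v) -
      fderivWithin ℝ (fun m => ⟪chartFlowDeriv J η x (1, 0) m, chartFlowDeriv J η x (0, v) m⟫_ℝ)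
          (chartCylinder J x) (s, z) (0, w) =
    fderivWithin ℝ (fun m => ⟪chartFlowDeriv J η x (1, 0) m, chartFlowDeriv J η x (0, w) m⟫_ℝ)
          (chartCylinder J x) (t, z) (0, v) -
      fderivWithin ℝ (fun m => ⟪chartFlowDeriv J η x (1, 0) m, chartFlowDeriv J η x (0, v) m⟫_ℝ)
          (chartCylinder J x) (t, z) (0, w) := by
  set S := chartCylinder J x with hSdef
  set F : E3 → ℝ × E3 → ℝ := fun w m =>
    ⟪chartFlowDeriv J η x (1, 0) m, chartFlowDeriv J η x (0, w) m⟫_ℝ with hF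
  have hS := uniqueDiffOn_chartCylinder hJ hJ' x
  have ho : IsOpen (extChartAt (𝓡 3) x).target := isOpen_extChartAt_target x
  have hFs : ∀ w, ContDiffOn ℝ ∞ (F w) S := fun w =>
    contDiffOn_inner_chartFlowDeriv hη hJ hJ' x (1, 0) (0, w)
  have hFd : ∀ w, DifferentiableOn ℝ (fderivWithin ℝ (F w) S) S := fun w =>
    ((hFs w).fderivWithin (m := 1) hS
      (by rw [one_add_one_eq_two]; exact ENat.LEInfty.out)).differentiableOn (by simp)
  have happ : ∀ w {m}, m ∈ S → ∀ ν, HasFDerivWithinAt (fun m => fderivWithin ℝ (F w) S m ν)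
      ((ContinuousLinearMap.apply ℝ ℝ ν).comp (fderivWithin ℝ (fderivWithin ℝ (F w) S) S m)) S m :=
    fun w m hm ν => (ContinuousLinearMap.apply ℝ ℝ ν).hasFDerivAt.comp_hasFDerivWithinAt m
      (hFd w m hm).hasFDerivWithinAt
  refine eq_of_hasDerivWithinAt_zero hJ hJ' (f := fun s => fderivWithin ℝ (F w) S (s, z) (0, v) -
    fderivWithin ℝ (F v) S (s, z) (0, w)) (fun r hr => ?_) hs ht
  have hm : (r, z) ∈ S := ⟨hr, hz⟩
  obtain ⟨E, hE, hE'⟩ := exists_fderivWithin_inner_chartFlowDeriv hu hη hJ hJ' x hr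
  have hEz : ContDiffAt ℝ ∞ E z := hE.contDiffAt (ho.mem_nhds hz)
  have hEd : DifferentiableAt ℝ (fderiv ℝ E) z :=
    (hEz.fderiv_right (m := 1)
      (by rw [one_add_one_eq_two]; exact ENat.LEInfty.out)).differentiableAt (by simp)
  have hEs : IsSymmSndFDerivAt ℝ E z :=
    hEz.isSymmSndFDerivAt (by simpa using (ENat.LEInfty.out : (2 : ℕ∞ω) ≤ ∞))
  have hsymm : ∀ w, IsSymmSndFDerivWithinAt ℝ (F w) S (r, z) := fun w =>
    (hFs w (r, z) hm).isSymmSndFDerivWithinAt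
      (by simpa using (ENat.LEInfty.out : (2 : ℕ∞ω) ≤ ∞)) hS
      (chartCylinder_subset_closure_interior hJ hJ' x hm) hm
  have hpar : HasDerivWithinAt (fun s : ℝ => (s, z)) ((1 : ℝ), (0 : E3)) J r :=
    (hasDerivWithinAt_id r J).prodMk (hasDerivWithinAt_const r J z)
  have htime : ∀ v w, HasDerivWithinAt (fun s => fderivWithin ℝ (F w) S (s, z) (0, v))
      (fderivWithin ℝ (fderivWithin ℝ (F w) S) S (r, z) (1, 0) (0, v)) J r := fun v w => by
    have h := (happ w hm (0, v)).comp_hasDerivWithinAt r hpar (fun s hs => mk_mem_prod hs hz)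
    exact h
  -- `∂ₜ∂_v F_w = ∂_v∂ₜ F_w = ∂_v∂_w E`, which is symmetric in `v` and `w`; the antisymmetrized
  -- derivative therefore has time derivative zero.
  have hspace : ∀ v w, fderivWithin ℝ (fderivWithin ℝ (F w) S) S (r, z) (1, 0) (0, v) =
      fderiv ℝ (fderiv ℝ E) z v w := fun v w => by
    rw [hsymm w (1, 0) (0, v)]
    have h1 := ((happ w hm (1, 0)).comp z (hasFDerivAt_prodMk_right r z).hasFDerivWithinAt
      (fun y (hy : y ∈ (extChartAt (𝓡 3) x).target) => mk_mem_prod hr hy)).hasFDerivAt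
        (ho.mem_nhds hz)
    have h2 : HasFDerivAt (fun y => fderiv ℝ E y w)
        ((ContinuousLinearMap.apply ℝ ℝ w).comp (fderiv ℝ (fderiv ℝ E) z)) z :=
      (ContinuousLinearMap.apply ℝ ℝ w).hasFDerivAt.comp z hEd.hasFDerivAt
    have h3 := h2.congr_of_eventuallyEq (f₁ := (fun m => fderivWithin ℝ (F w) S m (1, 0)) ∘
      fun y => (r, y)) (by
        filter_upwards [ho.mem_nhds hz] with y hy using hE' y hy w)
    exact congr($(h1.unique h3) v)
  have h := (htime v w).sub (htime w v)
  rwa [hspace v w, hspace w v, hEs v w, sub_self] at h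

/-- Vorticity conservation: the pull back of `du^♭` under the flow is constant in time. -/
theorem IsEulerSolution.vorticity_conservation (hu : IsEulerSolution J u) (hη : IsFlow J u η)
    (hJ : J.OrdConnected) (hJ' : J.Nontrivial) (x : M) (v w : T x) {s t : ℝ} (hs : s ∈ J)
    (ht : t ∈ J) :
    ⟪covDeriv (u s) (η s x) (D (η s) x v), D (η s) x w⟫_ℝ -
        ⟪covDeriv (u s) (η s x) (D (η s) x w), D (η s) x v⟫_ℝ =
      ⟪covDeriv (u t) (η t x) (D (η t) x v), D (η t) x w⟫_ℝ -
        ⟪covDeriv (u t) (η t x) (D (η t) x w), D (η t) x v⟫_ℝ := by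
  have hS := uniqueDiffOn_chartCylinder (M := M) hJ hJ' x
  have key : ∀ z ∈ (extChartAt (𝓡 3) x).target, ∀ v w : E3, ∀ r ∈ J,
      fderivWithin ℝ (fun m => ⟪chartFlowDeriv J η x (1, 0) m, chartFlowDeriv J η x (0, w) m⟫_ℝ)
          (chartCylinder J x) (r, z) (0, v) -
      fderivWithin ℝ (fun m => ⟪chartFlowDeriv J η x (1, 0) m, chartFlowDeriv J η x (0, v) m⟫_ℝ)
          (chartCylinder J x) (r, z) (0, w) =
      ⟪covDeriv (u r) (chartFlow η x (r, z)) (D (η r) ((extChartAt (𝓡 3) x).symm z)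
        (coordVec x z v)), D (η r) ((extChartAt (𝓡 3) x).symm z) (coordVec x z w)⟫_ℝ -
      ⟪covDeriv (u r) (chartFlow η x (r, z)) (D (η r) ((extChartAt (𝓡 3) x).symm z)
        (coordVec x z w)), D (η r) ((extChartAt (𝓡 3) x).symm z) (coordVec x z v)⟫_ℝ := by
    intro z hz v w r hr
    have hm : (r, z) ∈ chartCylinder J x := ⟨hr, hz⟩
    obtain ⟨Z, h1, h2, -, h4⟩ := hη.exists_hasCovDerivWithin_chartFlowDeriv hu.smooth hJ hJ' x hm
    obtain ⟨A, hA, hA'⟩ := (h1 (1, 0)).inner (h1 (0, w)) hm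
    obtain ⟨B, hB, hB'⟩ := (h1 (1, 0)).inner (h1 (0, v)) hm
    -- The terms in which `∂_w η` or `∂_v η` is differentiated agree by symmetry and cancel in the
    -- difference.
    have r1 : Z (0, v) (0, w) = Z (0, w) (0, v) := h2 _ _
    rw [hA.fderivWithin (hS _ hm), hB.fderivWithin (hS _ hm), hA', hB', r1, h4, h4]
    rw [add_sub_add_right_eq_sub]
    have s1 := hη.chartFlowDeriv_space x hm v
    have s2 := hη.chartFlowDeriv_space x hm w
    rw [s1, s2]
  have key2 : ∀ y : M, (∃ z ∈ (extChartAt (𝓡 3) x).target, (extChartAt (𝓡 3) x).symm z = y) →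
      ∀ v w : T y, ⟪covDeriv (u s) (η s y) (D (η s) y v), D (η s) y w⟫_ℝ -
        ⟪covDeriv (u s) (η s y) (D (η s) y w), D (η s) y v⟫_ℝ =
      ⟪covDeriv (u t) (η t y) (D (η t) y v), D (η t) y w⟫_ℝ -
        ⟪covDeriv (u t) (η t y) (D (η t) y w), D (η t) y v⟫_ℝ := by
    rintro _ ⟨z, hz, rfl⟩ v w
    have h1 := key z hz (coords x _ v) (coords x _ w) s hs
    have h2 := key z hz (coords x _ v) (coords x _ w) t ht
    rw [coordVec_coords x hz, coordVec_coords x hz] at h1 h2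
    exact h1.symm.trans ((curl_chart_const hu hη hJ hJ' x hz _ _ hs ht).trans h2)
  exact key2 x ⟨_, mem_extChartAt_target x, extChartAt_to_inv x⟩ v w

end Vorticity

/-! ### Cross product and curl in an oriented three-dimensional space -/

section Cross

variable {M : Type*} [TopologicalSpace M] [ChartedSpace E3 M]
  [RiemannianBundle (fun x : M => TangentSpace (𝓡 3) x)] {x : M}

lemma inner_cross (o : Orientation ℝ (T x) (Fin 3)) (a b c : T x) :
    ⟪cross o a b, c⟫_ℝ = o.volumeForm ![a, b, c] := by
  have hc := (stdOrthonormalBasis ℝ (T x)).sum_repr' c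
  have hlin : ∀ c, o.volumeForm ![a, b, c] =
      o.volumeForm.toMultilinearMap.toLinearMap ![a, b, 0] 2 c := fun c => by
    rw [MultilinearMap.toLinearMap_apply]
    refine congr_arg o.volumeForm ?_
    ext i; fin_cases i <;> rfl
  conv_rhs => rw [← hc, hlin, map_sum]
  rw [cross, sum_inner]
  refine Finset.sum_congr rfl fun i _ => ?_
  rw [map_smul, ← hlin, inner_smul_left, RCLike.conj_to_real, smul_eq_mul, mul_comm]

/-- Reduces vector identities to polynomial ones. The sign `ε` records whether the chosen basis has
the orientation `o`. -/
lemma exists_volumeForm_eq (o : Orientation ℝ (T x) (Fin 3)) :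
    ∃ (e : OrthonormalBasis (Fin 3) ℝ (T x)) (ε : ℝ), ε * ε = 1 ∧ ∀ a b c,
      o.volumeForm ![a, b, c] = ε * (e.repr a 0 * (e.repr b 1 * e.repr c 2 - e.repr b 2 * e.repr c 1) -
        e.repr a 1 * (e.repr b 0 * e.repr c 2 - e.repr b 2 * e.repr c 0) +
        e.repr a 2 * (e.repr b 0 * e.repr c 1 - e.repr b 1 * e.repr c 0)) := by
  let e := (stdOrthonormalBasis ℝ (T x)).reindex
    (finCongr (Fact.out : Module.finrank ℝ (T x) = 3))
  have hdet : ∀ a b c : T x, e.toBasis.det ![a, b, c] =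
      (e.repr a 0 * (e.repr b 1 * e.repr c 2 - e.repr b 2 * e.repr c 1) -
        e.repr a 1 * (e.repr b 0 * e.repr c 2 - e.repr b 2 * e.repr c 0) +
        e.repr a 2 * (e.repr b 0 * e.repr c 1 - e.repr b 1 * e.repr c 0)) := by
    intro a b c
    rw [Module.Basis.det_apply, Matrix.det_fin_three]
    simp [Module.Basis.toMatrix_apply]
    ring
  by_cases h : e.toBasis.orientation = o
  · refine ⟨e, 1, by norm_num, fun a b c => ?_⟩
    rw [o.volumeForm_robust e h, hdet, one_mul]
  · refine ⟨e, -1, by norm_num, fun a b c => ?_⟩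
    rw [o.volumeForm_robust_neg e h, ← hdet, neg_one_mul]
    rfl

lemma inner_eq_sum_repr (e : OrthonormalBasis (Fin 3) ℝ (T x)) (a b : T x) :
    ⟪a, b⟫_ℝ = e.repr a 0 * e.repr b 0 + e.repr a 1 * e.repr b 1 + e.repr a 2 * e.repr b 2 := by
  rw [← e.repr.inner_map_map a b, PiLp.inner_apply, Fin.sum_univ_three]
  simp only [RCLike.inner_apply, RCLike.conj_to_real]
  ring

/-- The triple product expansion `⟨(a × b) × c, d⟩ = ⟨a, c⟩⟨b, d⟩ - ⟨a, d⟩⟨b, c⟩`. -/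
lemma volumeForm_cross (o : Orientation ℝ (T x) (Fin 3)) (a b c d : T x) :
    o.volumeForm ![cross o a b, c, d] = ⟪a, c⟫_ℝ * ⟪b, d⟫_ℝ - ⟪a, d⟫_ℝ * ⟪b, c⟫_ℝ := by
  obtain ⟨e, ε, hε, he⟩ := exists_volumeForm_eq o
  have hcr : ∀ i, e.repr (cross o a b) i = o.volumeForm ![a, b, e i] := fun i => by
    rw [← inner_cross, real_inner_comm, e.repr_apply_apply]
  rw [he]
  simp only [hcr, he, inner_eq_sum_repr e]
  simp
  -- The cross product and the volume form contribute a factor `ε` each, so the left side is `ε²`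
  -- times the right side, which is the coefficient of `hε`.
  linear_combination (((e.repr a).ofLp 0 * (e.repr c).ofLp 0 + (e.repr a).ofLp 1 * (e.repr c).ofLp 1
    + (e.repr a).ofLp 2 * (e.repr c).ofLp 2) * ((e.repr b).ofLp 0 * (e.repr d).ofLp 0
    + (e.repr b).ofLp 1 * (e.repr d).ofLp 1 + (e.repr b).ofLp 2 * (e.repr d).ofLp 2) -
    ((e.repr a).ofLp 0 * (e.repr d).ofLp 0 + (e.repr a).ofLp 1 * (e.repr d).ofLp 1
    + (e.repr a).ofLp 2 * (e.repr d).ofLp 2) * ((e.repr b).ofLp 0 * (e.repr c).ofLp 0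
    + (e.repr b).ofLp 1 * (e.repr c).ofLp 1 + (e.repr b).ofLp 2 * (e.repr c).ofLp 2)) * hε

/-- Cramer's rule `vol(a,b,c) ξ = vol(ξ,b,c) a + vol(a,ξ,c) b + vol(a,b,ξ) c`, paired with `ξ`. For
`b, c ⟂ ξ` only the first term survives. -/
lemma inner_self_mul_volumeForm (o : Orientation ℝ (T x) (Fin 3)) (ξ a b c : T x) :
    ⟪ξ, ξ⟫_ℝ * o.volumeForm ![a, b, c] = ⟪ξ, a⟫_ℝ * o.volumeForm ![ξ, b, c] +
      ⟪ξ, b⟫_ℝ * o.volumeForm ![a, ξ, c] + ⟪ξ, c⟫_ℝ * o.volumeForm ![a, b, ξ] := by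
  obtain ⟨e, ε, -, he⟩ := exists_volumeForm_eq o
  simp only [he, inner_eq_sum_repr e]
  ring

variable [IsManifold (𝓡 3) ∞ M]
  [IsContMDiffRiemannianBundle (𝓡 3) ∞ E3 (fun x : M => TangentSpace (𝓡 3) x)]

/-- The covariant derivative `v ↦ ∇_v Y` as a continuous linear map. -/
noncomputable def covDerivL (Y : ∀ x : M, T x) (p : M) : T p →L[ℝ] T p :=
  (show T p →L[ℝ] T p from fderiv ℝ
      (fun y : E3 => coords p ((extChartAt (𝓡 3) p).symm y) (Y ((extChartAt (𝓡 3) p).symm y)))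
      (extChartAt (𝓡 3) p p)) + christoffelL p (Y p)

/-- The triple product expansion, applied to each `eᵢ × ∇_{eᵢ} Y`, gives sums that reassemble `b`
and `c` from their components. -/
lemma volumeForm_curl (o : Orientation ℝ (T x) (Fin 3)) (Y : ∀ x : M, T x) (b c : T x) :
    o.volumeForm ![curl o Y, b, c] = ⟪covDeriv Y x b, c⟫_ℝ - ⟪covDeriv Y x c, b⟫_ℝ := by
  set L := covDerivL Y x
  have hL : ∀ v, covDeriv Y x v = L v := fun _ => rfl
  have hlin : ∀ a, o.volumeForm ![a, b, c] =
      o.volumeForm.toMultilinearMap.toLinearMap ![0, b, c] 0 a := fun a => by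
    rw [MultilinearMap.toLinearMap_apply]
    refine congr_arg o.volumeForm ?_
    ext i; fin_cases i <;> rfl
  have hsum : ∀ v w : T x, ⟪L v, w⟫_ℝ = ∑ i, ⟪stdOrthonormalBasis ℝ (T x) i, v⟫_ℝ *
      ⟪L (stdOrthonormalBasis ℝ (T x) i), w⟫_ℝ := fun v w => by
    conv_lhs => rw [← (stdOrthonormalBasis ℝ (T x)).sum_repr' v]
    rw [map_sum, sum_inner]
    refine Finset.sum_congr rfl fun i _ => ?_
    rw [map_smul, inner_smul_left, RCLike.conj_to_real]
  rw [curl, hlin, map_sum]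
  simp only [← hlin, volumeForm_cross, hL]
  rw [Finset.sum_sub_distrib, ← hsum, ← hsum]

/-- On the plane orthogonal to `ξ`, only the component of the curl along `ξ` matters. -/
lemma inner_covDeriv_sub_of_orthogonal (o : Orientation ℝ (T x) (Fin 3)) (Y : ∀ x : M, T x)
    {ξ b c : T x} (hξ : ξ ≠ 0) (hb : ⟪b, ξ⟫_ℝ = 0) (hc : ⟪c, ξ⟫_ℝ = 0) :
    ⟪covDeriv Y x b, c⟫_ℝ - ⟪covDeriv Y x c, b⟫_ℝ =
      ⟪(⟪ξ, curl o Y⟫_ℝ / ⟪ξ, ξ⟫_ℝ) • cross o ξ b, c⟫_ℝ := by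
  have h := inner_self_mul_volumeForm o ξ (curl o Y) b c
  rw [real_inner_comm b ξ, real_inner_comm c ξ, hb, hc, zero_mul, zero_mul, add_zero, add_zero] at h
  have hξ' : ⟪ξ, ξ⟫_ℝ ≠ 0 := inner_self_ne_zero.2 hξ
  rw [← volumeForm_curl o Y b c, inner_smul_left, RCLike.conj_to_real, inner_cross,
    div_mul_eq_mul_div, ← h, mul_div_cancel_left₀ _ hξ']

end Cross

/-! ### The phase equation and transport of gradients -/

section Phase

open Filter Topology

variable {M : Type*} [TopologicalSpace M] [ChartedSpace E3 M] [IsManifold (𝓡 3) ∞ M]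
  [RiemannianBundle (fun x : M => TangentSpace (𝓡 3) x)]
  [IsContMDiffRiemannianBundle (𝓡 3) ∞ E3 (fun x : M => TangentSpace (𝓡 3) x)]
  {J : Set ℝ} {u : ℝ → ∀ x : M, T x} {η : ℝ → M ≃ₘ⟮𝓡 3, 𝓡 3⟯ M}

/-- Chain rule for `Φ` on `J × M`: the path has velocity `(1, u) = (1, 0) + (0, u)`. -/
lemma IsFlow.hasDerivWithinAt_comp (hη : IsFlow J u η) {Φ : ℝ → M → ℝ}
    (hΦ : ContMDiffOn (𝓘(ℝ, ℝ).prod (𝓡 3)) 𝓘(ℝ, ℝ) 1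
      (fun p : ℝ × M => Φ p.1 p.2) (J ×ˢ univ)) (hJ : UniqueDiffOn ℝ J) (x : M) {t : ℝ}
    (ht : t ∈ J) :
    HasDerivWithinAt (fun s => Φ s (η s x)) (derivWithin (fun s => Φ s (η t x)) J t +
      (show ℝ from mfderiv (𝓡 3) 𝓘(ℝ, ℝ) (Φ t) (η t x) (u t (η t x)))) J t := by
  have hF := ((hΦ (t, η t x) (mk_mem_prod ht (mem_univ _))).mdifferentiableWithinAt
    one_ne_zero).hasMFDerivWithinAt
  set F' := mfderivWithin (𝓘(ℝ, ℝ).prod (𝓡 3)) 𝓘(ℝ, ℝ) (fun p : ℝ × M => Φ p.1 p.2)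
    (J ×ˢ univ) (t, η t x)
  have hid : HasMFDerivWithinAt 𝓘(ℝ, ℝ) 𝓘(ℝ, ℝ) (fun s : ℝ => s) J t
      (ContinuousLinearMap.id ℝ (TangentSpace 𝓘(ℝ, ℝ) t)) := hasMFDerivWithinAt_id _ _
  have h1 := HasMFDerivWithinAt.comp t hF (hid.prodMk (hη.flow t ht x))
    (fun s hs => mk_mem_prod hs (mem_univ _))
  have h2 := HasMFDerivWithinAt.comp t hF
    (hid.prodMk (hasMFDerivWithinAt_const (I' := 𝓡 3) (η t x) J t))
    (fun s hs => mk_mem_prod hs (mem_univ _))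
  have h3 := HasMFDerivWithinAt.comp (η t x) hF
    ((hasMFDerivWithinAt_const (I := 𝓡 3) (I' := 𝓘(ℝ, ℝ)) t univ (η t x)).prodMk
      (hasMFDerivWithinAt_id (I := 𝓡 3) univ (η t x)))
    (fun s hs => mk_mem_prod ht (mem_univ _))
  let F : ℝ × E3 →L[ℝ] ℝ := F'
  have e1 : HasFDerivWithinAt (fun s => Φ s (η s x)) (F.comp ((ContinuousLinearMap.id ℝ ℝ).prod
      (ContinuousLinearMap.toSpanSingleton ℝ (show E3 from u t (η t x))))) J t :=
    hasMFDerivWithinAt_iff_hasFDerivWithinAt.1 h1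
  have e2 : HasFDerivWithinAt (fun s => Φ s (η t x))
      (F.comp ((ContinuousLinearMap.id ℝ ℝ).prod 0)) J t :=
    hasMFDerivWithinAt_iff_hasFDerivWithinAt.1 h2
  have e3 : mfderiv (𝓡 3) 𝓘(ℝ, ℝ) (Φ t) (η t x) (u t (η t x)) = F (0, u t (η t x)) :=
    congr($((hasMFDerivWithinAt_univ.1 h3).mfderiv) (u t (η t x)))
  have e4 : derivWithin (fun s => Φ s (η t x)) J t = F (1, 0) :=
    e2.hasDerivWithinAt.derivWithin (hJ t ht)
  refine e1.hasDerivWithinAt.congr_deriv ?_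
  have key : ∀ v : E3, F (1, v) = F (1, 0) + F (0, v) := fun v => by
    rw [← map_add, Prod.mk_add_mk, add_zero, zero_add]
  refine Eq.trans ?_ (congr_arg₂ (fun a b : ℝ => a + b) e4 e3).symm
  refine Eq.trans ?_ (key (u t (η t x)))
  exact congr_arg F (Prod.ext rfl (one_smul ℝ (show E3 from u t (η t x))))

/-- Method of characteristics: the equation says that `Φ` is constant along each path, and every
point of `M` lies on a path at every time. In the converse the `C¹` regularity comes from joint
smoothness of the inverse flow. -/
lemma isPhase_iff (hη : IsFlow J u η) (hJ : J.OrdConnected) (hJ' : J.Nontrivial)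
    (h0 : (0 : ℝ) ∈ J) {Φ₀ : M → ℝ} (hΦ₀ : ContMDiff (𝓡 3) 𝓘(ℝ, ℝ) 1 Φ₀) (Φ : ℝ → M → ℝ) :
    (IsPhase J u Φ ∧ Φ 0 = Φ₀) ↔ ∀ t ∈ J, Φ t = Φ₀ ∘ (η t).symm := by
  have hu := uniqueDiffOn_of_ordConnected hJ hJ'
  constructor
  · rintro ⟨hΦ, rfl⟩ t ht
    funext y
    have h1 := eq_of_hasDerivWithinAt_zero hJ hJ' (fun s hs =>
      (hη.hasDerivWithinAt_comp hΦ.contMDiff hu ((η t).symm y) hs).congr_deriv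
        (hΦ.eqn s hs _)) ht h0
    simpa [hη.zero] using h1
  · intro h
    have hc : ContMDiffOn (𝓘(ℝ, ℝ).prod (𝓡 3)) 𝓘(ℝ, ℝ) 1
        (fun p : ℝ × M => Φ p.1 p.2) (J ×ˢ univ) :=
      (hΦ₀.comp_contMDiffOn (hη.smooth_symm.of_le (by simp))).congr
        (fun p hp => congr_fun (h p.1 hp.1) p.2)
    refine ⟨⟨hc, fun t ht y => ?_⟩, ?_⟩
    · have h1 := hη.hasDerivWithinAt_comp hc hu ((η t).symm y) ht
      have h2 : HasDerivWithinAt (fun s => Φ s (η s ((η t).symm y))) 0 J t :=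
        (hasDerivWithinAt_const t J (Φ₀ ((η t).symm y))).congr
          (fun s hs => by rw [h s hs]; simp) (by rw [h t ht]; simp)
      have h3 := (hu t ht).eq_deriv _ h1 h2
      rwa [(η t).apply_symm_apply y] at h3
    · rw [h 0 h0]
      funext y
      have : (η 0).symm y = y := by
        conv_lhs => rw [← hη.zero y]
        exact (η 0).symm_apply_apply y
      simp [this]

lemma grad_comp {f : M → ℝ} (hf : MDifferentiable (𝓡 3) 𝓘(ℝ, ℝ) f) (e : M ≃ₘ⟮𝓡 3, 𝓡 3⟯ M) (y : M) :
    grad (f ∘ e) y = ContinuousLinearMap.adjoint (D e y) (grad f (e y)) := by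
  refine ext_inner_right ℝ fun v => ?_
  rw [ContinuousLinearMap.adjoint_inner_left, inner_grad, inner_grad,
    mfderiv_comp y (hf _) hasMFDerivAt_D.mdifferentiableAt]
  rfl

/-- If `f = f₀ ∘ e⁻¹`, then `df(De v) = df₀(v)`. -/
lemma inner_D_grad {f f₀ : M → ℝ} (hf : MDifferentiable (𝓡 3) 𝓘(ℝ, ℝ) f)
    {e : M ≃ₘ⟮𝓡 3, 𝓡 3⟯ M} (h : f₀ = f ∘ e) (x : M) (v : T x) :
    ⟪D e x v, grad f (e x)⟫_ℝ = ⟪v, grad f₀ x⟫_ℝ := by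
  rw [h, grad_comp hf e x, ContinuousLinearMap.adjoint_inner_right]

/-- The differential of a diffeomorphism as a linear equivalence. -/
noncomputable def DEquiv (e : M ≃ₘ⟮𝓡 3, 𝓡 3⟯ M) (x : M) : T x ≃L[ℝ] T (e x) :=
  e.mfderivToContinuousLinearEquiv (by simp) x

lemma isInvertible_D (e : M ≃ₘ⟮𝓡 3, 𝓡 3⟯ M) (x : M) : (D e x).IsInvertible :=
  ⟨DEquiv e x, rfl⟩

lemma D_surjective (e : M ≃ₘ⟮𝓡 3, 𝓡 3⟯ M) (x : M) : Function.Surjective (D e x) :=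
  (DEquiv e x).surjective

lemma grad_ne_zero_iff {f f₀ : M → ℝ} (hf : MDifferentiable (𝓡 3) 𝓘(ℝ, ℝ) f)
    {e : M ≃ₘ⟮𝓡 3, 𝓡 3⟯ M} (h : f₀ = f ∘ e) (x : M) :
    grad f (e x) ≠ 0 ↔ grad f₀ x ≠ 0 := by
  refine not_congr ⟨fun h1 => ?_, fun h1 => ?_⟩
  · refine ext_inner_left ℝ fun v => ?_
    rw [← inner_D_grad hf h x v, h1, inner_zero_right, inner_zero_right]
  · refine ext_inner_left ℝ fun v => ?_
    obtain ⟨w, rfl⟩ := D_surjective e x v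
    rw [inner_D_grad hf h x w, h1, inner_zero_right, inner_zero_right]

/-- `η 0` is the identity only propositionally, so its tangent spaces at `η 0 x` and `x` are
different types; a variable `f` makes substitution possible. -/
lemma eq_of_eq_mfderiv_of_eq_id {f : M → M} (hf : f = id) (Y : ∀ x : M, T x) (x : M) {v : T x}
    (h : Y (f x) = mfderiv (𝓡 3) (𝓡 3) f x v) : v = Y x := by
  subst hf
  rw [mfderiv_id] at h
  exact h.symm

lemma inner_covDeriv_mfderiv_of_eq_id {f : M → M} (hf : f = id) (Y : ∀ x : M, T x) (x : M)
    (v w : T x) :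
    ⟪covDeriv Y (f x) (mfderiv (𝓡 3) (𝓡 3) f x v), mfderiv (𝓡 3) (𝓡 3) f x w⟫_ℝ =
      ⟪covDeriv Y x v, w⟫_ℝ := by
  subst hf
  rw [mfderiv_id]
  rfl

/-- In a chart the gradient vanishes exactly where the derivative of the coordinate expression does,
and that derivative is continuous. -/
lemma isOpen_grad_ne_zero {f : M → ℝ} (hf : ContMDiff (𝓡 3) 𝓘(ℝ, ℝ) 1 f) :
    IsOpen {x | grad f x ≠ 0} := by
  rw [isOpen_iff_mem_nhds]
  intro p hp
  have ho : IsOpen (extChartAt (𝓡 3) p).target := isOpen_extChartAt_target p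
  have hg : ContDiffOn ℝ 1 (f ∘ (extChartAt (𝓡 3) p).symm) (extChartAt (𝓡 3) p).target := by
    rw [← contMDiffOn_iff_contDiffOn]
    exact hf.comp_contMDiffOn (contMDiffOn_extChartAt_symm p)
  have hfd : ∀ y ∈ (extChartAt (𝓡 3) p).target, ∀ v : E3,
      fderiv ℝ (f ∘ (extChartAt (𝓡 3) p).symm) y v =
        ⟪grad f ((extChartAt (𝓡 3) p).symm y), coordVec p y v⟫_ℝ := by
    intro y hy v
    have h6 : MDifferentiableAt 𝓘(ℝ, E3) (𝓡 3) (extChartAt (𝓡 3) p).symm y :=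
      ((contMDiffOn_extChartAt_symm (n := ∞) p).contMDiffAt (ho.mem_nhds hy)).mdifferentiableAt
        (by simp)
    have h7 := mfderiv_comp y (hf.mdifferentiable one_ne_zero _) h6
    rw [inner_grad, ← mfderiv_eq_fderiv]
    exact congr($h7 v)
  have hcont : ContinuousAt (fderiv ℝ (f ∘ (extChartAt (𝓡 3) p).symm)) (extChartAt (𝓡 3) p p) :=
    (hg.continuousOn_fderiv_of_isOpen ho le_rfl).continuousAt (extChartAt_target_mem_nhds p)
  have hne : fderiv ℝ (f ∘ (extChartAt (𝓡 3) p).symm) (extChartAt (𝓡 3) p p) ≠ 0 := by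
    intro h0
    have key : ∀ q, q = p → grad f q = 0 → grad f p = 0 := by rintro _ rfl h; exact h
    refine hp (key _ (extChartAt_to_inv (I := 𝓡 3) p) (ext_inner_right ℝ fun v => ?_))
    rw [← coordVec_coords p (mem_extChartAt_target p) v, ← hfd _ (mem_extChartAt_target p), h0,
      inner_zero_left]
    rfl
  have hev := (continuousAt_extChartAt (I := 𝓡 3) p).eventually (hcont.eventually_ne hne)
  filter_upwards [hev, extChartAt_source_mem_nhds (I := 𝓡 3) p] with q h1 h2 h3
  refine h1 (ContinuousLinearMap.ext fun v => ?_)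
  rw [hfd _ ((extChartAt (𝓡 3) p).map_source h2)]
  have key : ∀ q', q' = q → grad f q' = 0 := by rintro _ rfl; exact h3
  rw [key _ ((extChartAt (𝓡 3) p).left_inv h2), inner_zero_left]
  rfl

end Phase

/-! ### The amplitude along the paths of the flow -/

section Amplitude

open Filter Topology

variable {M : Type*} [TopologicalSpace M] [ChartedSpace E3 M] [IsManifold (𝓡 3) ∞ M]
  [RiemannianBundle (fun x : M => TangentSpace (𝓡 3) x)]
  [IsContMDiffRiemannianBundle (𝓡 3) ∞ E3 (fun x : M => TangentSpace (𝓡 3) x)]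
  {J : Set ℝ} {u : ℝ → ∀ x : M, T x} {η : ℝ → M ≃ₘ⟮𝓡 3, 𝓡 3⟯ M}

section Along

variable {γ : ℝ → M} {α β : ∀ t : ℝ, T (γ t)} {t : ℝ} {Z W : T (γ t)}

lemma HasCovDerivAlong.unique (h : HasCovDerivAlong J γ α t Z) (h' : HasCovDerivAlong J γ α t W)
    (hJ : UniqueDiffWithinAt ℝ J t) : Z = W := by
  obtain ⟨v, hv, -⟩ := id h
  have h1 := ((hasCovDerivAlong_iff hJ hv).1 h).unique ((hasCovDerivAlong_iff hJ hv).1 h') hJ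
  have h2 := congr($h1 1)
  simpa using h2

lemma HasCovDerivAlong.inner (h : HasCovDerivAlong J γ α t Z) (h' : HasCovDerivAlong J γ β t W)
    (hJ : UniqueDiffWithinAt ℝ J t) (ht : t ∈ J) :
    HasDerivWithinAt (fun s => ⟪α s, β s⟫_ℝ) (⟪Z, β t⟫_ℝ + ⟪α t, W⟫_ℝ) J t := by
  obtain ⟨v, hv, -⟩ := id h
  obtain ⟨F, h1, h2⟩ := ((hasCovDerivAlong_iff hJ hv).1 h).inner
    ((hasCovDerivAlong_iff hJ hv).1 h') ht
  refine h1.hasDerivWithinAt.congr_deriv ?_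
  rw [h2]
  simp

end Along

/-- The regular set is the preimage of the open set `∇Φ₀ ≠ 0` under the continuous map `(t, y) ↦
η(t)⁻¹ y`, hence relatively open in `J × M`. -/
lemma regularSet_mem_nhdsWithin (hη : IsFlow J u η) {Φ₀ : M → ℝ}
    (hΦ₀ : ContMDiff (𝓡 3) 𝓘(ℝ, ℝ) 1 Φ₀) {Φ : ℝ → M → ℝ}
    (hΦ : ∀ t ∈ J, Φ t = Φ₀ ∘ (η t).symm) {t : ℝ} (ht : t ∈ J) {y : M}
    (hy : grad (Φ t) y ≠ 0) : regularSet J Φ ∈ 𝓝[J ×ˢ univ] (t, y) := by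
  have hc : ContinuousOn (fun p : ℝ × M => (η p.1).symm p.2) (J ×ˢ univ) :=
    hη.smooth_symm.continuousOn
  have hiff : ∀ s ∈ J, ∀ y, grad (Φ s) y ≠ 0 ↔ grad Φ₀ ((η s).symm y) ≠ 0 := fun s hs y =>
    (grad_ne_zero_iff (e := (η s).symm) (hΦ₀.mdifferentiable one_ne_zero) (hΦ s hs) y).symm
  have hmem : (t, y) ∈ J ×ˢ (univ : Set M) := mk_mem_prod ht (mem_univ _)
  have h1 := (hc (t, y) hmem).eventually
    ((isOpen_grad_ne_zero hΦ₀).mem_nhds ((hiff t ht y).1 hy))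
  filter_upwards [h1, self_mem_nhdsWithin] with p hp hp'
  exact ⟨hp'.1, (hiff p.1 hp'.1 p.2).2 hp⟩

/-- The covariant derivative along the paths of the flow is the material derivative. -/
lemma IsFlow.hasCovDerivAlong_field (hη : IsFlow J u η) (hJ : UniqueDiffOn ℝ J)
    {a : ℝ → ∀ x : M, T x} (x : M) {t : ℝ} (ht : t ∈ J)
    (ha : ContMDiffWithinAt (𝓘(ℝ, ℝ).prod (𝓡 3)) (𝓡 3).tangent 1
      (fun p : ℝ × M => (⟨p.2, a p.1 p.2⟩ : TangentBundle (𝓡 3) M)) (J ×ˢ univ) (t, η t x)) :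
    HasCovDerivAlong J (fun s => η s x) (fun s => a s (η s x)) t
      (derivWithin (fun s => a s (η t x)) J t + covDeriv (a t) (η t x) (u t (η t x))) := by
  obtain ⟨Z, h1, h2⟩ := exists_hasCovDerivWithin_of_contMDiffWithinAt (G := fun s => η s x)
    (hJ t ht) ht (hasFDerivWithinAt_id t J) (fun s hs => hs) (hη.flow t ht x) ha
  rw [hasCovDerivAlong_iff (hJ t ht) (hη.flow t ht x)]
  refine (congr_arg (HasCovDerivWithin J (fun s => η s x) (fun s => a s (η s x)) t
    (ContinuousLinearMap.toSpanSingleton ℝ (u t (η t x)))) ?_).mp h1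
  refine ContinuousLinearMap.ext_ring ?_
  refine (h2 1).trans (Eq.trans ?_ (one_smul ℝ _).symm)
  refine congr_arg₂ (fun a b => a + b) (one_smul ℝ _) ?_
  exact congr_arg _ (one_smul ℝ _)

lemma differentiableWithinAt_of_apply {B : ℝ → E3 →L[ℝ] E3} {t : ℝ}
    (h : ∀ w, DifferentiableWithinAt ℝ (fun s => B s w) J t) : DifferentiableWithinAt ℝ B J t := by
  -- An operator is determined linearly by its values on the three basis vectors.
  have hsum : ∀ s, B s = ∑ i, ContinuousLinearMap.smulRightL ℝ E3 E3
      (EuclideanSpace.proj i : E3 →L[ℝ] ℝ) (B s (EuclideanSpace.single i 1)) := fun s => by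
    ext w : 1
    have hw : w = ∑ i, w i • EuclideanSpace.single i (1 : ℝ) := by
      ext j; simp [Pi.single_apply]
    conv_lhs => rw [hw]
    simp [map_sum]
  rw [funext hsum]
  exact DifferentiableWithinAt.fun_sum fun i _ => (ContinuousLinearMap.smulRightL ℝ E3 E3
    (EuclideanSpace.proj i : E3 →L[ℝ] ℝ)).differentiableAt.comp_differentiableWithinAt t
      (h (EuclideanSpace.single i 1))

/-- Differentiation of `β` in `α = Dη β`. -/
lemma IsFlow.exists_hasDerivWithinAt_of_eq_D (hη : IsFlow J u η)
    (hu : ContMDiffOn (𝓘(ℝ, ℝ).prod (𝓡 3)) (𝓡 3).tangent ∞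
      (fun p : ℝ × M => (⟨p.2, u p.1 p.2⟩ : TangentBundle (𝓡 3) M)) (J ×ˢ univ))
    (hJ : J.OrdConnected) (hJ' : J.Nontrivial) (x : M) {t : ℝ} (ht : t ∈ J)
    {α : ∀ s, T (η s x)} {β : ℝ → T x} (hβ : ∀ s ∈ J, α s = D (η s) x (β s)) {Z : T (η t x)}
    (hα : HasCovDerivAlong J (fun s => η s x) α t Z) :
    ∃ β' : T x, HasDerivWithinAt β β' J t ∧
      D (η t) x β' = Z - covDeriv (u t) (η t x) (α t) := by
  have hU := uniqueDiffOn_of_ordConnected hJ hJ' t ht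
  have hv := hη.flow t ht x
  have hA := ((hasCovDerivAlong_iff hU hv).1 hα).field.hasDerivWithinAt
  -- `Dη(s, x)` with target read in the fixed chart at `η(t, x)`, so that it acts between spaces
  -- independent of `s`.
  let B : ℝ → E3 →L[ℝ] E3 := fun s => (coords (η t x) (η s x)).comp (D (η s) x)
  have hBw : ∀ w : E3, HasDerivWithinAt (fun s => B s w)
      (show T (η t x) from covDeriv (u t) (η t x) (D (η t) x w) -
        christoffel (η t x) (u t (η t x)) (D (η t) x w)) J t := fun w => by
    obtain ⟨v', hv', h⟩ := hη.hasCovDerivAlong_D hu hJ hJ' x ht w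
    have : v' = u t (η t x) := by
      have h3 := congr($(UniqueMDiffWithinAt.eq hU.uniqueMDiffWithinAt hv' hv) (1 : ℝ))
      exact (one_smul ℝ v').symm.trans (h3.trans (one_smul ℝ _))
    rw [this] at h
    exact h
  have hB := (differentiableWithinAt_of_apply fun w => (hBw w).differentiableWithinAt).hasDerivWithinAt
  set B' := derivWithin B J t
  have hinv : ∀ s, η s x ∈ (extChartAt (𝓡 3) (η t x)).source → (B s).IsInvertible := fun s hs =>
    (isInvertible_mfderiv_extChartAt hs).comp (isInvertible_D (η s) x)
  -- No regularity of `β` is assumed: near `t` it equals `B⁻¹` applied to the components of `α`, and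
  -- inversion of operators is differentiable.
  have hev : ∀ᶠ s in 𝓝[J] t, β s = (B s).inverse (coords (η t x) (η s x) (α s)) := by
    have hc : ContinuousWithinAt (fun s => η s x) J t := (hasMFDerivWithinAt_iff_extChartAt.1 hv).1
    filter_upwards [hc (extChartAt_source_mem_nhds (I := 𝓡 3) (η t x)), self_mem_nhdsWithin]
      with s h1 h2
    refine ((hinv s h1).inverse_apply_eq.2 ?_).symm
    rw [hβ s h2]
    rfl
  have hdiff : DifferentiableWithinAt ℝ β J t := by
    obtain ⟨e, he⟩ := hinv t (mem_extChartAt_source _)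
    have h1 : DifferentiableAt ℝ (ContinuousLinearMap.inverse : (E3 →L[ℝ] E3) → E3 →L[ℝ] E3)
        (B t) := by
      rw [← he]
      exact (contDiffAt_map_inverse (n := 1) e).differentiableAt one_ne_zero
    have h2 : DifferentiableWithinAt ℝ (fun s => (B s).inverse (coords (η t x) (η s x) (α s))) J t :=
      (h1.comp_differentiableWithinAt t hB.differentiableWithinAt).clm_apply
        hA.differentiableWithinAt
    exact h2.congr_of_eventuallyEq hev (hev.self_of_nhdsWithin ht)
  obtain ⟨β', hβ'⟩ : ∃ β' : E3, HasDerivWithinAt (fun s => (show E3 from β s)) β' J t :=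
    ⟨_, hdiff.hasDerivWithinAt⟩
  refine ⟨β', hβ', ?_⟩
  -- Differentiating `Bβ` gives `B'β + Bβ' = Z - Γ(u, α)`, while the linearized flow gives `B'β =
  -- ∇_α u - Γ(u, α)`; the Christoffel terms cancel.
  have h1 : HasDerivWithinAt (fun s => coords (η t x) (η s x) (α s))
      (B' (β t) + B t β') J t :=
    (hB.clm_apply hβ').congr (fun s hs => by rw [hβ s hs]; rfl) (by rw [hβ t ht]; rfl)
  have h2 := hU.eq_deriv _ h1 hA
  have h3 := hU.eq_deriv _ (hB.clm_apply (hasDerivWithinAt_const t J (show E3 from β t)))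
    (hBw (β t))
  rw [map_zero, add_zero] at h3
  have h4 : B t β' = D (η t) x β' := coords_self_apply (η t x) (D (η t) x β')
  have h5 : ∀ p q r z : T (η t x), (p - q) + r = z - q → r = z - p := fun p q r z h => by
    rw [← sub_eq_zero] at h ⊢
    rw [← h]; abel
  rw [hβ t ht]
  refine h5 _ (christoffel (η t x) (u t (η t x)) (D (η t) x (β t))) _ _ ?_
  refine (congr_arg₂ (fun a b : E3 => a + b) h3 h4).symm.trans (h2.trans ?_)
  refine congr_arg₂ (fun a b : T (η t x) => a - b) (one_smul ℝ Z) ?_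
  rw [← hβ t ht]
  exact congr_arg (fun v => christoffel (η t x) v (α t)) (one_smul ℝ (u t (η t x)))

end Amplitude

/-! ### Equivalence of the amplitude equation and the two path equations -/

section ODE

open Filter Topology

variable {M : Type*} [TopologicalSpace M] [ChartedSpace E3 M] [IsManifold (𝓡 3) ∞ M]
  [RiemannianBundle (fun x : M => TangentSpace (𝓡 3) x)]
  [IsContMDiffRiemannianBundle (𝓡 3) ∞ E3 (fun x : M => TangentSpace (𝓡 3) x)]
  {J : Set ℝ} {u : ℝ → ∀ x : M, T x} {η : ℝ → M ≃ₘ⟮𝓡 3, 𝓡 3⟯ M}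

/-- The derivative of `⟨β, ξ⟩`, for `α = Dη β`. -/
lemma IsFlow.hasDerivWithinAt_inner_grad (hη : IsFlow J u η)
    (hu : ContMDiffOn (𝓘(ℝ, ℝ).prod (𝓡 3)) (𝓡 3).tangent ∞
      (fun p : ℝ × M => (⟨p.2, u p.1 p.2⟩ : TangentBundle (𝓡 3) M)) (J ×ˢ univ))
    (hJ : J.OrdConnected) (hJ' : J.Nontrivial) (x : M) {t : ℝ} (ht : t ∈ J)
    {f f₀ : M → ℝ} (hf : MDifferentiable (𝓡 3) 𝓘(ℝ, ℝ) f) (hf₀ : f₀ = f ∘ η t)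
    {α : ∀ s, T (η s x)} {β : ℝ → T x} (hβ : ∀ s ∈ J, α s = D (η s) x (β s)) {Z : T (η t x)}
    (hα : HasCovDerivAlong J (fun s => η s x) α t Z) :
    HasDerivWithinAt (fun s => ⟪β s, grad f₀ x⟫_ℝ)
      ⟪Z - covDeriv (u t) (η t x) (α t), grad f (η t x)⟫_ℝ J t := by
  obtain ⟨β', h1, h2⟩ := hη.exists_hasDerivWithinAt_of_eq_D hu hJ hJ' x ht hβ hα
  have h3 := (innerSL ℝ (grad f₀ x)).hasFDerivAt.comp_hasDerivWithinAt t h1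
  refine (h3.congr_deriv ?_).congr (fun s _ => real_inner_comm _ _) (real_inner_comm _ _)
  rw [← h2, inner_D_grad hf hf₀ x β', innerSL_apply_apply, real_inner_comm]

/-- The force balances two copies of `∇_α u`: one from the equation itself, one from differentiating
`Dη` in `α = Dη β`. Thus `⟨β, ξ⟩` stays constant. -/
lemma inner_amplitudeForce (u : ∀ x : M, T x) (f : M → ℝ) (y : M) (b : T y)
    (hf : grad f y ≠ 0) :
    ⟪amplitudeForce u f y b, grad f y⟫_ℝ = 2 * ⟪covDeriv u y b, grad f y⟫_ℝ := by
  have : ⟪grad f y, grad f y⟫_ℝ ≠ 0 := inner_self_ne_zero.2 hf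
  rw [amplitudeForce, inner_smul_left, RCLike.conj_to_real]
  field_simp

/-- A vector whose inner product with `Dη w` vanishes for all `w ⟂ ∇f₀` is a multiple of `∇f`. -/
lemma eq_smul_grad {f f₀ : M → ℝ} (hf : MDifferentiable (𝓡 3) 𝓘(ℝ, ℝ) f)
    {e : M ≃ₘ⟮𝓡 3, 𝓡 3⟯ M} (h : f₀ = f ∘ e) {x : M} (hne : grad f (e x) ≠ 0) {Y : T (e x)}
    (hY : ∀ w : T x, ⟪w, grad f₀ x⟫_ℝ = 0 → ⟪Y, D e x w⟫_ℝ = 0) :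
    Y = (⟪Y, grad f (e x)⟫_ℝ / ⟪grad f (e x), grad f (e x)⟫_ℝ) • grad f (e x) := by
  have hne' : ⟪grad f (e x), grad f (e x)⟫_ℝ ≠ 0 := inner_self_ne_zero.2 hne
  refine ext_inner_right ℝ fun v => ?_
  -- The part of `v` orthogonal to `∇f` is `De w` with `w ⟂ ∇f₀`, so `Y` pairs to zero with it.
  obtain ⟨w, hw⟩ := D_surjective e x
    (v - (⟪v, grad f (e x)⟫_ℝ / ⟪grad f (e x), grad f (e x)⟫_ℝ) • grad f (e x))
  have h1 := hY w (by
    rw [← inner_D_grad hf h, hw, inner_sub_left, inner_smul_left, RCLike.conj_to_real,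
      div_mul_cancel₀ _ hne', sub_self])
  rw [hw, inner_sub_right, inner_smul_right, sub_eq_zero] at h1
  rw [h1, inner_smul_left, RCLike.conj_to_real, real_inner_comm v]
  ring

/-- Characterization of the derivative of `π Λ β` through inner products. -/
lemma hasDerivWithinAt_projPerp_iff (hη : IsFlow J u η)
    (hu : ContMDiffOn (𝓘(ℝ, ℝ).prod (𝓡 3)) (𝓡 3).tangent ∞
      (fun p : ℝ × M => (⟨p.2, u p.1 p.2⟩ : TangentBundle (𝓡 3) M)) (J ×ˢ univ))
    (hJ : J.OrdConnected) (hJ' : J.Nontrivial) (x : M) {t : ℝ} (ht : t ∈ J) (ξ : T x)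
    {α : ∀ s, T (η s x)} {β : ℝ → T x} (hβ : ∀ s ∈ J, α s = D (η s) x (β s)) {Z : T (η t x)}
    (hα : HasCovDerivAlong J (fun s => η s x) α t Z) (V : T x) :
    HasDerivWithinAt (fun s => projPerp ξ (deformation (η s) x (β s))) V J t ↔
      ∀ w : T x, ⟪V, w⟫_ℝ = ⟪Z, D (η t) x (projPerp ξ w)⟫_ℝ +
        ⟪α t, covDeriv (u t) (η t x) (D (η t) x (projPerp ξ w))⟫_ℝ := by
  have hU := uniqueDiffOn_of_ordConnected hJ hJ' t ht
  -- Moving the projection and `Dηᵀ` onto `w` leaves `α` and `Dη (π w)`, whose covariant derivatives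
  -- are known.
  have hin : ∀ s ∈ J, ∀ w : T x, ⟪projPerp ξ (deformation (η s) x (β s)), w⟫_ℝ =
      ⟪α s, D (η s) x (projPerp ξ w)⟫_ℝ := fun s hs w => by
    rw [projPerp, Submodule.inner_starProjection_left_eq_right, deformation,
      ContinuousLinearMap.comp_apply, ContinuousLinearMap.adjoint_inner_left, hβ s hs]
  have hd : ∀ w : T x, HasDerivWithinAt
      (fun s => ⟪projPerp ξ (deformation (η s) x (β s)), w⟫_ℝ)
      (⟪Z, D (η t) x (projPerp ξ w)⟫_ℝ +
        ⟪α t, covDeriv (u t) (η t x) (D (η t) x (projPerp ξ w))⟫_ℝ) J t := fun w =>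
    (hα.inner (hη.hasCovDerivAlong_D hu hJ hJ' x ht (projPerp ξ w)) hU ht).congr
      (fun s hs => hin s hs w) (hin t ht w)
  constructor
  · intro h w
    have h3 := (innerSL ℝ w).hasFDerivAt.comp_hasDerivWithinAt t h
    have h4 := hU.eq_deriv _ (h3.congr (fun s _ => real_inner_comm _ _) (real_inner_comm _ _))
      (hd w)
    rwa [innerSL_apply_apply, real_inner_comm] at h4
  · intro h
    have e := stdOrthonormalBasis ℝ (T x)
    have h1 : HasDerivWithinAt (fun s => ∑ i,
        ⟪projPerp ξ (deformation (η s) x (β s)), e i⟫_ℝ • e i) (∑ i, ⟪V, e i⟫_ℝ • e i) J t :=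
      HasDerivWithinAt.fun_sum fun i _ => by
        rw [h]
        exact (hd (e i)).smul_const (e i)
    have h2 : ∀ v : T x, ∑ i, ⟪v, e i⟫_ℝ • e i = v := fun v => by
      simp only [real_inner_comm _ v]
      exact e.sum_repr' v
    simpa only [h2] using h1

variable {Φ₀ : M → ℝ} {Φ : ℝ → M → ℝ}

/-- The path equation in `T_{η(t, x)} M` is equivalent to the one in the fixed tangent space. -/
lemma rightODE_iff_leftODE (hu : IsEulerSolution J u) (hη : IsFlow J u η)
    (hJ : J.OrdConnected) (hJ' : J.Nontrivial) (h0 : (0 : ℝ) ∈ J)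
    (hΦd : ∀ t ∈ J, MDifferentiable (𝓡 3) 𝓘(ℝ, ℝ) (Φ t)) (hΦ : ∀ t ∈ J, Φ₀ = Φ t ∘ η t)
    (x : M) (o : Orientation ℝ (T x) (Fin 3)) (hne : grad Φ₀ x ≠ 0)
    {α : ∀ s, T (η s x)} {β : ℝ → T x} (hβ : ∀ s ∈ J, α s = D (η s) x (β s))
    (hα : ∀ t ∈ J, ∃ Z, HasCovDerivAlong J (fun s => η s x) α t Z) :
    RightODE J u η Φ x α ↔ LeftODE J η x o (grad Φ₀ x) (curl o (u 0)) β := by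
  have hU := uniqueDiffOn_of_ordConnected hJ hJ'
  have hne' : ∀ t ∈ J, grad (Φ t) (η t x) ≠ 0 := fun t ht =>
    (grad_ne_zero_iff (hΦd t ht) (hΦ t ht) x).2 hne
  have horth : ∀ t ∈ J, ⟪α t, grad (Φ t) (η t x)⟫_ℝ = ⟪β t, grad Φ₀ x⟫_ℝ := fun t ht => by
    rw [hβ t ht, inner_D_grad (hΦd t ht) (hΦ t ht)]
  have hid : ⇑(η 0) = id := funext hη.zero
  have hproj : ∀ w : T x, ⟪projPerp (grad Φ₀ x) w, grad Φ₀ x⟫_ℝ = 0 := fun w =>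
    Submodule.mem_orthogonal_singleton_iff_inner_left.1 (Submodule.starProjection_apply_mem _ _)
  have hproj' : ∀ w : T x, ⟪w, grad Φ₀ x⟫_ℝ = 0 → projPerp (grad Φ₀ x) w = w := fun w hw =>
    Submodule.starProjection_eq_self_iff.2 (Submodule.mem_orthogonal_singleton_iff_inner_left.2 hw)
  -- `ξ × b` is already orthogonal to `ξ`, so the projection does not change it.
  have hcross : ∀ b w : T x, ⟪cross o (grad Φ₀ x) b, projPerp (grad Φ₀ x) w⟫_ℝ =
      ⟪cross o (grad Φ₀ x) b, w⟫_ℝ := fun b w => by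
    have h1 : ⟪cross o (grad Φ₀ x) b, grad Φ₀ x⟫_ℝ = 0 := by
      rw [inner_cross]
      exact o.volumeForm.map_eq_zero_of_eq _ (i := 0) (j := 2) rfl (by decide)
    rw [projPerp, ← Submodule.inner_starProjection_left_eq_right]
    rw [show (ℝ ∙ grad Φ₀ x)ᗮ.starProjection (cross o (grad Φ₀ x) b) = _ from hproj' _ h1]
  -- Under the constraint, the projected equation says only that `Z + ∇_α u` is orthogonal to the
  -- image of `ξ^⊥` under `Dη`.
  have key : ∀ t ∈ J, ∀ Z, HasCovDerivAlong J (fun s => η s x) α t Z →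
      ⟪β t, grad Φ₀ x⟫_ℝ = 0 →
      (HasDerivWithinAt (fun s => projPerp (grad Φ₀ x) (deformation (η s) x (β s)))
        (-((⟪grad Φ₀ x, curl o (u 0)⟫_ℝ / ⟪grad Φ₀ x, grad Φ₀ x⟫_ℝ) •
          cross o (grad Φ₀ x) (β t))) J t ↔
      ∀ w : T x, ⟪w, grad Φ₀ x⟫_ℝ = 0 →
        ⟪Z + covDeriv (u t) (η t x) (α t), D (η t) x w⟫_ℝ = 0) := by
    intro t ht Z hZ hb
    -- Vorticity conservation between `t` and 0: at time 0 the flow is the identity, and the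
    -- antisymmetric part of `∇u₀` on `ξ^⊥` is the curl term.
    have hvort : ∀ w : T x, ⟪w, grad Φ₀ x⟫_ℝ = 0 →
        ⟪α t, covDeriv (u t) (η t x) (D (η t) x w)⟫_ℝ =
          ⟪covDeriv (u t) (η t x) (α t), D (η t) x w⟫_ℝ -
          ⟪(⟪grad Φ₀ x, curl o (u 0)⟫_ℝ / ⟪grad Φ₀ x, grad Φ₀ x⟫_ℝ) •
            cross o (grad Φ₀ x) (β t), w⟫_ℝ := fun w hw => by
      have h1 := hu.vorticity_conservation hη hJ hJ' x (β t) w ht h0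
      have h2 := inner_covDeriv_mfderiv_of_eq_id hid (u 0) x (β t) w
      have h3 := inner_covDeriv_mfderiv_of_eq_id hid (u 0) x w (β t)
      have h4 := inner_covDeriv_sub_of_orthogonal o (u 0) hne hb hw
      rw [← h4, ← h2, ← h3]
      rw [← hβ t ht, real_inner_comm (α t) (covDeriv (u t) (η t x) (D (η t) x w))] at h1
      have h5 : ∀ a b c d : ℝ, a - b = c - d → b = a - (c - d) := fun a b c d h => by linarith
      exact h5 _ _ _ _ h1
    rw [hasDerivWithinAt_projPerp_iff hη hu.smooth hJ hJ' x ht _ hβ hZ]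
    have hstep : ∀ w : T x, (⟪-((⟪grad Φ₀ x, curl o (u 0)⟫_ℝ / ⟪grad Φ₀ x, grad Φ₀ x⟫_ℝ) •
          cross o (grad Φ₀ x) (β t)), w⟫_ℝ = ⟪Z, D (η t) x (projPerp (grad Φ₀ x) w)⟫_ℝ +
        ⟪α t, covDeriv (u t) (η t x) (D (η t) x (projPerp (grad Φ₀ x) w))⟫_ℝ) ↔
        ⟪Z + covDeriv (u t) (η t x) (α t), D (η t) x (projPerp (grad Φ₀ x) w)⟫_ℝ = 0 := fun w => by
      rw [hvort _ (hproj w), inner_add_left, inner_neg_left, inner_smul_left, inner_smul_left,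
        hcross]
      constructor <;> intro h <;> linarith
    constructor
    · intro h w hw
      have := (hstep w).1 (h w)
      rwa [hproj' w hw] at this
    · intro h w
      exact (hstep w).2 (h _ (hproj w))
  constructor
  · intro h t ht
    obtain ⟨h1, h2⟩ := h t ht
    have hb : ⟪β t, grad Φ₀ x⟫_ℝ = 0 := by rw [← horth t ht, h2]
    refine ⟨(key t ht _ h1 hb).2 fun w hw => ?_, hb⟩
    rw [sub_add_cancel, amplitudeForce, inner_smul_left,
      real_inner_comm (D (η t) x w), inner_D_grad (hΦd t ht) (hΦ t ht), hw, mul_zero]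
  · intro h t ht
    obtain ⟨Z, hZ⟩ := hα t ht
    obtain ⟨h1, hb⟩ := h t ht
    -- Hence `Z + ∇_α u` is a multiple of `∇Φ`. Differentiating the constraint gives `⟨Z, ∇Φ⟩ = ⟨∇_α
    -- u, ∇Φ⟩`, which produces the factor 2.
    have h2 := eq_smul_grad (hΦd t ht) (hΦ t ht) (hne' t ht) ((key t ht Z hZ hb).1 h1)
    have h3 := hη.hasDerivWithinAt_inner_grad hu.smooth hJ hJ' x ht (hΦd t ht) (hΦ t ht) hβ hZ
    have h4 : HasDerivWithinAt (fun s => ⟪β s, grad Φ₀ x⟫_ℝ) 0 J t :=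
      (hasDerivWithinAt_const t J (0 : ℝ)).congr (fun s hs => (h s hs).2) hb
    have h5 := (hU t ht).eq_deriv _ h3 h4
    have h6 : ⟪Z + covDeriv (u t) (η t x) (α t), grad (Φ t) (η t x)⟫_ℝ =
        2 * ⟪covDeriv (u t) (η t x) (α t), grad (Φ t) (η t x)⟫_ℝ := by
      rw [inner_sub_left] at h5
      rw [inner_add_left]
      linarith
    rw [h6, mul_div_assoc] at h2
    refine ⟨?_, by rw [horth t ht, hb]⟩
    have h7 : amplitudeForce (u t) (Φ t) (η t x) (α t) - covDeriv (u t) (η t x) (α t) = Z := by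
      rw [sub_eq_iff_eq_add]; exact h2.symm
    rw [h7]
    exact hZ

/-- The amplitude equation is equivalent to the path equations along all Lagrangian paths. -/
lemma amplitudeEqn_iff_rightODE (hu : IsEulerSolution J u) (hη : IsFlow J u η)
    (hJ : J.OrdConnected) (hJ' : J.Nontrivial) (h0 : (0 : ℝ) ∈ J)
    (hΦd : ∀ t ∈ J, MDifferentiable (𝓡 3) 𝓘(ℝ, ℝ) (Φ t)) (hΦ : ∀ t ∈ J, Φ₀ = Φ t ∘ η t)
    (hΦ0 : Φ 0 = Φ₀) {a : ℝ → ∀ x : M, T x}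
    (ha : ∀ x, grad Φ₀ x ≠ 0 → ∀ t ∈ J, HasCovDerivAlong J (fun s => η s x)
      (fun s => a s (η s x)) t
      (derivWithin (fun s => a s (η t x)) J t + covDeriv (a t) (η t x) (u t (η t x)))) :
    (AmplitudeEqn J u Φ a ∧ ∀ x : M, ⟪a 0 x, grad Φ₀ x⟫_ℝ = 0) ↔
      ∀ x : M, grad Φ₀ x ≠ 0 → RightODE J u η Φ x (fun t => a t (η t x)) := by
  have hU := uniqueDiffOn_of_ordConnected hJ hJ'
  have hne : ∀ x, ∀ t ∈ J, grad (Φ t) (η t x) ≠ 0 ↔ grad Φ₀ x ≠ 0 := fun x t ht =>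
    grad_ne_zero_iff (hΦd t ht) (hΦ t ht) x
  constructor
  · rintro ⟨h1, h2⟩ x hx
    have hcov : ∀ t ∈ J, HasCovDerivAlong J (fun s => η s x) (fun s => a s (η s x)) t
        (amplitudeForce (u t) (Φ t) (η t x) (a t (η t x)) -
          covDeriv (u t) (η t x) (a t (η t x))) := fun t ht => by
      rw [← h1 t (η t x) ⟨ht, (hne x t ht).2 hx⟩, add_sub_cancel_right]
      exact ha x hx t ht
    let β : ℝ → T x := fun t => (DEquiv (η t) x).symm (a t (η t x))
    have hβ : ∀ t ∈ J, a t (η t x) = D (η t) x (β t) := fun t _ =>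
      ((DEquiv (η t) x).apply_symm_apply _).symm
    have hin : ∀ t ∈ J, ⟪a t (η t x), grad (Φ t) (η t x)⟫_ℝ = ⟪β t, grad Φ₀ x⟫_ℝ := fun t ht => by
      rw [hβ t ht, inner_D_grad (hΦd t ht) (hΦ t ht)]
    refine fun t ht => ⟨hcov t ht, ?_⟩
    -- The derivative of `⟨β, ξ⟩` is `⟨force - 2 ∇_α u, ∇Φ⟩ = 0`.
    have hconst := eq_of_hasDerivWithinAt_zero hJ hJ' (f := fun s => ⟪β s, grad Φ₀ x⟫_ℝ)
      (fun s hs => (hη.hasDerivWithinAt_inner_grad (α := fun s => a s (η s x)) hu.smooth hJ hJ' x hs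
        (hΦd s hs) (hΦ s hs) hβ (hcov s hs)).congr_deriv (by
          rw [inner_sub_left, inner_sub_left, inner_amplitudeForce _ _ _ _ ((hne x s hs).2 hx)]
          ring)) ht h0
    rw [hin t ht]
    refine hconst.trans ?_
    show ⟪β 0, grad Φ₀ x⟫_ℝ = 0
    rw [← hin 0 h0, hΦ0]
    exact h2 _
  · intro h
    refine ⟨fun t y hy => ?_, fun x => ?_⟩
    · obtain ⟨ht, hy⟩ := hy
      -- Each point is reached by a path at time `t`, so equations along paths give the equation on
      -- the whole regular set.
      obtain ⟨x, rfl⟩ : ∃ x, η t x = y := (η t).surjective y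
      have hx := (hne x t ht).1 hy
      have h1 := (ha x hx t ht).unique (h x hx t ht).1 (hU t ht)
      rw [h1, sub_add_cancel]
    · by_cases hx : grad Φ₀ x = 0
      · rw [hx, inner_zero_right]
      · have h1 := (h x hx 0 h0).2
        rw [hΦ0] at h1
        have key : ∀ y, y = x → ⟪a 0 y, grad Φ₀ y⟫_ℝ = 0 → ⟪a 0 x, grad Φ₀ x⟫_ℝ = 0 := by
          rintro _ rfl h; exact h
        exact key _ (hη.zero x) h1

end ODE

end WKB

theorem mainTheorem10 {M : Type*} [TopologicalSpace M] [T2Space M] [CompactSpace M]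
    [ChartedSpace WKB.E3 M] [IsManifold (𝓡 3) ∞ M]
    [RiemannianBundle (fun x : M => TangentSpace (𝓡 3) x)]
    [IsContMDiffRiemannianBundle (𝓡 3) ∞ WKB.E3 (fun x : M => TangentSpace (𝓡 3) x)]
    (o : ∀ x : M, Orientation ℝ (WKB.T x) (Fin 3))
    (J : Set ℝ) (hJ : J.OrdConnected) (hJ' : J.Nontrivial) (h0 : (0 : ℝ) ∈ J)
    (u : ℝ → ∀ x : M, WKB.T x) (hu : WKB.IsEulerSolution J u)
    (η : ℝ → M ≃ₘ⟮𝓡 3, 𝓡 3⟯ M) (hη : WKB.IsFlow J u η)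
    (Φ₀ : M → ℝ) (hΦ₀ : ContMDiff (𝓡 3) 𝓘(ℝ, ℝ) 1 Φ₀) :
    -- the phase
    (∀ Φ : ℝ → M → ℝ,
      (WKB.IsPhase J u Φ ∧ Φ 0 = Φ₀) ↔ ∀ t ∈ J, Φ t = Φ₀ ∘ (η t).symm) ∧
    ∀ Φ : ℝ → M → ℝ, WKB.IsPhase J u Φ → Φ 0 = Φ₀ →
      -- the gradient of the phase
      (∀ t ∈ J, ∀ y : M, WKB.grad (Φ t) y =
        ContinuousLinearMap.adjoint (WKB.D (η t).symm y) (WKB.grad Φ₀ ((η t).symm y))) ∧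
      -- the amplitude
      ∀ a : ℝ → ∀ x : M, WKB.T x,
        ContMDiffOn (𝓘(ℝ, ℝ).prod (𝓡 3)) (𝓡 3).tangent 1
          (fun p : ℝ × M => (⟨p.2, a p.1 p.2⟩ : TangentBundle (𝓡 3) M)) (WKB.regularSet J Φ) →
        -- the ODE along Lagrangian paths
        ((WKB.AmplitudeEqn J u Φ a ∧ ∀ x : M, ⟪a 0 x, WKB.grad Φ₀ x⟫_ℝ = 0) ↔
          ∀ x : M, WKB.grad Φ₀ x ≠ 0 →
            WKB.RightODE J u η Φ x (fun t => a t (η t x))) ∧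
        -- the ODE in a fixed tangent space
        ((WKB.AmplitudeEqn J u Φ a ∧ ∀ x : M, ⟪a 0 x, WKB.grad Φ₀ x⟫_ℝ = 0) ↔
          ∀ x : M, WKB.grad Φ₀ x ≠ 0 →
            ∃ β : ℝ → WKB.T x, β 0 = a 0 x ∧
              (∀ t ∈ J, a t (η t x) = WKB.D (η t) x (β t)) ∧
              WKB.LeftODE J η x (o x) (WKB.grad Φ₀ x) (WKB.curl (o x) (u 0)) β) := by
  have hU := WKB.uniqueDiffOn_of_ordConnected hJ hJ'
  have hphase := WKB.isPhase_iff hη hJ hJ' h0 hΦ₀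
  refine ⟨hphase, fun Φ hΦ hΦ0 => ?_⟩
  have hΦs := (hphase Φ).1 ⟨hΦ, hΦ0⟩
  have hΦ₀d : MDifferentiable (𝓡 3) 𝓘(ℝ, ℝ) Φ₀ := hΦ₀.mdifferentiable one_ne_zero
  have hΦd : ∀ t ∈ J, MDifferentiable (𝓡 3) 𝓘(ℝ, ℝ) (Φ t) := fun t ht => by
    rw [hΦs t ht]
    exact hΦ₀d.comp ((η t).symm.mdifferentiable (by simp))
  have hΦc : ∀ t ∈ J, Φ₀ = Φ t ∘ η t := fun t ht => by
    funext x
    simp [hΦs t ht]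
  refine ⟨fun t ht y => ?_, fun a ha => ?_⟩
  · rw [hΦs t ht]
    exact WKB.grad_comp hΦ₀d (η t).symm y
  have hcov : ∀ x, WKB.grad Φ₀ x ≠ 0 → ∀ t ∈ J, WKB.HasCovDerivAlong J (fun s => η s x)
      (fun s => a s (η s x)) t (derivWithin (fun s => a s (η t x)) J t +
        WKB.covDeriv (a t) (η t x) (u t (η t x))) := fun x hx t ht => by
    have hne : WKB.grad (Φ t) (η t x) ≠ 0 := (WKB.grad_ne_zero_iff (hΦd t ht) (hΦc t ht) x).2 hx
    -- Relative openness of the regular set turns regularity within it into regularity within `J ×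
    -- M`.
    exact hη.hasCovDerivAlong_field hU x ht ((ha (t, η t x) ⟨ht, hne⟩).mono_of_mem_nhdsWithin
      (WKB.regularSet_mem_nhdsWithin hη hΦ₀ hΦs ht hne))
  have h1 := WKB.amplitudeEqn_iff_rightODE hu hη hJ hJ' h0 hΦd hΦc hΦ0 hcov
  refine ⟨h1, h1.trans (forall₂_congr fun x hx => ?_)⟩
  have hiff : ∀ β : ℝ → WKB.T x, (∀ t ∈ J, a t (η t x) = WKB.D (η t) x (β t)) →
      (WKB.RightODE J u η Φ x (fun t => a t (η t x)) ↔
        WKB.LeftODE J η x (o x) (WKB.grad Φ₀ x) (WKB.curl (o x) (u 0)) β) := fun β hβ =>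
    WKB.rightODE_iff_leftODE hu hη hJ hJ' h0 hΦd hΦc x (o x) hx hβ
      (fun t ht => ⟨_, hcov x hx t ht⟩)
  constructor
  · intro h
    -- The only possible `β` is `Dη⁻¹ α`; its initial value is `a 0 x` because `η 0` is the
    -- identity.
    have hβ : ∀ t ∈ J, a t (η t x) =
        WKB.D (η t) x ((WKB.DEquiv (η t) x).symm (a t (η t x))) := fun t _ =>
      ((WKB.DEquiv (η t) x).apply_symm_apply _).symm
    exact ⟨fun t => (WKB.DEquiv (η t) x).symm (a t (η t x)),
      WKB.eq_of_eq_mfderiv_of_eq_id (funext hη.zero) (a 0) x (hβ 0 h0), hβ, (hiff _ hβ).1 h⟩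
  · rintro ⟨β, -, hβ, h⟩
    exact (hiff β hβ).2 h
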